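/- **Theorem 5.3.** Let $n,m\in\mathbb N$, let $\Phi:\mathbb M_n(\mathbb C)\to\mathbb M_m(\mathbb C)$ be a quantum channel (a completely positive, trace-preserving linear map), and let $(\rho_\theta)_{\theta\in[0,1]}$ be a $C^\infty$ family of density matrices in $\mathbb M_n(\mathbb C)$ (positive semidefinite, trace one), with derivative $\dot\rho_\theta=\frac{d}{d\theta}\rho_\theta$ (one-sided at the endpoints). Write $\Phi(\rho)_\theta:=\Phi(\rho_\theta)$, and use the following notation. - Relative entropy: $D(\rho\|\sigma)=\operatorname{tr}(\rho\log\rho-\rho\log\sigma)$ if $\operatorname{supp}\rho\subseteq\operatorname{supp}\sigma$, and $D(\rho\|\sigma)=+\infty$ otherwise (logarithms are taken on the supports). - Max-relative entropy: $D_{\max}(\rho\|\sigma)=\log\inf\{C>0:\rho\le C\sigma\}$ in the Loewner order, equal to $+\infty$ if there is no such $C$. - BKM Fisher information: $I^{\mathrm{BKM}}_\rho(\theta)=\int_0^\infty\operatorname{tr}\big(\dot\rho_\theta(\rho_\theta+s)^{-1}\dot\rho_\theta(\rho_\theta+s)^{-1}\big)\,ds$, and likewise $I^{\mathrm{BKM}}_{\Phi(\rho)}$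 for the family $\Phi(\rho)$. (a) Suppose that all $\rho_\theta$, $\theta\in[0,1]$, have the same support (for instance, that all are of full rank). Then $D(\rho_1\|\rho_0)$, $D(\Phi(\rho_1)\|\Phi(\rho_0))$ and every $D_{\max}(\rho_1\|\rho_\theta)$ are finite, $I^{\mathrm{BKM}}_\rho(\theta)\ge I^{\mathrm{BKM}}_{\Phi(\rho)}(\theta)$ for all $\theta\in[0,1]$, the integrand below is integrable on $[0,1]$, and $$D(\rho_1\|\rho_0)-D(\Phi(\rho_1)\|\Phi(\rho_0))\le\int_0^1 e^{\frac12 D_{\max}(\rho_1\|\rho_\theta)}\sqrt{I^{\mathrm{BKM}}_\rho(\theta)-I^{\mathrm{BKM}}_{\Phi(\rho)}(\theta)}\;d\theta .$$ (b) In particular, if $\lambda>0$ and $\rho_\theta\ge\lambda I$ for all $\theta\in[0,1]$, then both relative entropies are finite, the integrand below is integrable on $[0,1]$, and $$D(\rho_1\|\rho_0)-D(\Phi(\rho_1)\|\Phi(\rho_0))\le\lambda^{-1/2}\int_0^1\sqrt{I^{\mathrm{BKM}}_\rho(\theta)-I^{\mathrm{BKM}}_{\Phi(\rho)}(\theta)}\;d\theta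 .$$ -/

import Mathlib

open Set
open scoped ContDiff MatrixOrder ComplexOrder Matrix.Norms.L2Operator CStarAlgebra Matrix

noncomputable section

namespace BKM

variable {n m : Type*} [Fintype n] [DecidableEq n] [Fintype m] [DecidableEq m]

/-- A density operator: positive semidefinite with trace one (no rank assumption). -/
def IsDensity (ρ : Matrix n n ℂ) : Prop := ρ.PosSemidef ∧ ρ.trace = 1

/-- A quantum channel: a completely positive (Mathlib's notion) trace-preserving linear map. -/
structure Channel (n m : Type*) [Fintype n] [DecidableEq n] [Fintype m] [DecidableEq m] where
  toCP : Matrix n n ℂ →CP Matrix m m ℂ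
  trace_map : ∀ A : Matrix n n ℂ, (toCP A).trace = A.trace

instance : CoeFun (Channel n m) (fun _ => Matrix n n ℂ → Matrix m m ℂ) := ⟨fun Φ => Φ.toCP⟩

/-- `supp ρ ⊆ supp σ` for Hermitian `ρ`, `σ`: the support is the orthogonal complement of the
kernel, so this says `ker σ ⊆ ker ρ`. -/
def SuppLE (ρ σ : Matrix n n ℂ) : Prop := ∀ v : n → ℂ, σ *ᵥ v = 0 → ρ *ᵥ v = 0

open Classical in
/-- Umegaki relative entropy `D(ρ‖σ) = tr(ρ log ρ - ρ log σ)` if `supp ρ ⊆ supp σ`, and `∞`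
otherwise. `CFC.log` is the functional calculus of `Real.log`; as `Real.log 0 = 0`, it is the
logarithm on the support, extended by `0`, for a positive semidefinite matrix. -/
def relEntropy (ρ σ : Matrix n n ℂ) : EReal :=
  if SuppLE ρ σ then (((ρ * CFC.log ρ - ρ * CFC.log σ).trace.re : ℝ) : EReal) else ⊤

open Classical in
/-- Max-relative entropy `D_max(ρ‖σ) = log inf {C > 0 | ρ ≤ C σ}` (Loewner order), equal to `∞`
if there is no such `C`. -/
def dMax (ρ σ : Matrix n n ℂ) : EReal :=
  if ∃ C : ℝ, 0 < C ∧ ρ ≤ C • σ then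
    ((Real.log (sInf {C : ℝ | 0 < C ∧ ρ ≤ C • σ}) : ℝ) : EReal) else ⊤

/-- The BKM metric `γ_ρ(A) = ∫₀^∞ tr(A* (ρ + s)⁻¹ A (ρ + s)⁻¹) ds`; the integral converges whenever
`A` is supported on the support of the positive semidefinite matrix `ρ`. -/
def bkmMetric (ρ A : Matrix n n ℂ) : ℝ :=
  ∫ s in Ioi (0 : ℝ),
    (Aᴴ * (ρ + s • (1 : Matrix n n ℂ))⁻¹ * A * (ρ + s • (1 : Matrix n n ℂ))⁻¹).trace.re

/-- BKM Fisher information of a family indexed by `[0,1]`, with one-sided derivatives at the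
endpoints. -/
def bkmFisher (ρ : ℝ → Matrix n n ℂ) (θ : ℝ) : ℝ :=
  bkmMetric (ρ θ) (derivWithin ρ (Icc 0 1) θ)

/-- The loss of BKM Fisher information of a family under a channel. -/
def bkmLoss (Φ : Channel n m) (ρ : ℝ → Matrix n n ℂ) (θ : ℝ) : ℝ :=
  bkmFisher ρ θ - bkmFisher (fun t => Φ (ρ t)) θ

end BKM

end

noncomputable section

namespace BKM

open MeasureTheory Filter Topology

/-! ### Scalar integrals: resolvent kernels, the logarithm and the logarithmic mean. -/

section Scalar

/-! Write γ_σ(A, B) for `bkmForm`. From log x = ∫₀^∞ ((1+s)⁻¹ − (x+s)⁻¹) ds, the θ-derivative of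
tr(ρ₁ log ρ_θ) is γ_{ρ_θ}(ρ₁, ρ̇_θ), so each relative entropy is an integral of such forms over
[0,1] (`trace_mul_log_sub`). The BKM metric is monotone under Φ, hence the metric loss along A + xB
is a nonnegative quadratic in x, and its discriminant gives a Cauchy–Schwarz inequality
(`bkmForm_sub_le`): the difference of the two integrands is at most √(loss at ρ₁) · √(loss at ρ̇_θ).
The loss at ρ₁ is at most γ_{ρ_θ}(ρ₁, ρ₁) ≤ C whenever ρ₁ ≤ Cρ_θ, because γ_σ(A, σ) = Re tr A
(`bkmMetric_le_of_le_smul`); the best C is exp D_max(ρ₁‖ρ_θ).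

Monotonicity (`Channel.bkmMetric_le`) comes from writing γ_σ(A, A) = ∫₀^∞ (1+t)⁻¹ ⟨A, (L_σ + tR_σ)⁻¹
A⟩ dt. Each inner product is the maximum over X of a functional affine in σ (`variational`), and a
test matrix Y on the output side is matched by its image under the adjoint of Φ, using a traced
Kadison–Schwarz inequality.

Singular states are handled by adding the projection Q onto their common kernel: ρ_θ + Q is positive
definite, has the same logarithm as ρ_θ, and gives the same metric on matrices annihilated by Q on
both sides. -/

theorem hasDerivAt_neg_inv_add {c x : ℝ} (hc : 0 < c) (hx : 0 ≤ x) :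
    HasDerivAt (fun s => -(c + s)⁻¹) (((c + x) ^ 2)⁻¹) x := by
  have hx' : c + x ≠ 0 := by positivity
  exact (((hasDerivAt_id x).const_add c).fun_inv hx').fun_neg.congr_deriv (by simp [neg_div])

theorem tendsto_neg_inv_add (c : ℝ) : Tendsto (fun s : ℝ => -(c + s)⁻¹) atTop (𝓝 0) := by
  have := (tendsto_inv_atTop_zero.comp (tendsto_atTop_add_const_left atTop c tendsto_id)).neg
  simpa using this

theorem integrableOn_inv_add_sq {c : ℝ} (hc : 0 < c) :
    IntegrableOn (fun s : ℝ => ((c + s) ^ 2)⁻¹) (Ioi 0) :=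
  integrableOn_Ioi_deriv_of_nonneg' (fun _ hx => hasDerivAt_neg_inv_add hc hx)
    (fun _ _ => by positivity) (tendsto_neg_inv_add c)

theorem integral_inv_add_sq {c : ℝ} (hc : 0 < c) :
    ∫ s in Ioi (0 : ℝ), ((c + s) ^ 2)⁻¹ = c⁻¹ := by
  rw [integral_Ioi_of_hasDerivAt_of_nonneg' (fun _ hx => hasDerivAt_neg_inv_add hc hx)
    (fun _ _ => by positivity) (tendsto_neg_inv_add c)]
  simp

theorem integrableOn_inv_mul_inv {a b : ℝ} (ha : 0 < a) (hb : 0 < b) :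
    IntegrableOn (fun s : ℝ => (a + s)⁻¹ * (b + s)⁻¹) (Ioi 0) := by
  have hc : 0 < min a b := lt_min ha hb
  refine Integrable.mono' (integrableOn_inv_add_sq hc)
    (by fun_prop) ((ae_restrict_iff' measurableSet_Ioi).2 (.of_forall fun s hs => ?_))
  have hs' : (0 : ℝ) < s := hs
  rw [Real.norm_of_nonneg (by positivity), sq, mul_inv]
  gcongr
  · exact min_le_left _ _
  · exact min_le_right _ _

/-- The reciprocal of the logarithmic mean of `a` and `b`. -/
def invLogMean (a b : ℝ) : ℝ := ∫ s in Ioi (0 : ℝ), (a + s)⁻¹ * (b + s)⁻¹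

theorem invLogMean_self {a : ℝ} (ha : 0 < a) : invLogMean a a = a⁻¹ := by
  rw [invLogMean, ← integral_inv_add_sq ha]
  simp only [sq, mul_inv]

/-- Substitute s = tb. The new kernel has a denominator linear in (a, b), which is what makes a
variational formula affine in the state possible. -/
theorem invLogMean_eq {a b : ℝ} (hb : 0 < b) :
    invLogMean a b = ∫ t in Ioi (0 : ℝ), (1 + t)⁻¹ * (a + t * b)⁻¹ := by
  have := integral_comp_mul_left_Ioi (fun s : ℝ => (a + s)⁻¹ * (b + s)⁻¹) 0 hb
  rw [mul_zero, smul_eq_mul, eq_inv_mul_iff_mul_eq₀ hb.ne', ← integral_const_mul] at this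
  rw [invLogMean, ← this]
  refine setIntegral_congr_fun measurableSet_Ioi fun t ht => ?_
  have ht' : (0 : ℝ) < t := ht
  have h1 : b + b * t = b * (1 + t) := by ring
  simp only [h1, mul_inv, mul_comm t b]
  field_simp

theorem integrableOn_inv_one_add_mul_inv {a b : ℝ} (ha : 0 < a) (hb : 0 < b) :
    IntegrableOn (fun t : ℝ => (1 + t)⁻¹ * (a + t * b)⁻¹) (Ioi 0) := by
  have h := (integrableOn_inv_mul_inv (a := 1) (b := a / b) one_pos (by positivity)).const_mul b⁻¹
  refine IntegrableOn.congr_fun h (fun t ht => ?_) measurableSet_Ioi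
  have ht' : (0 : ℝ) < t := ht
  have : a + t * b = b * (a / b + t) := by field_simp
  simp only [this, mul_inv]
  ring

theorem hasDerivAt_log_sub_log {a x : ℝ} (ha : 0 < a) (hx : 0 ≤ x) :
    HasDerivAt (fun s => Real.log (1 + s) - Real.log (a + s)) ((1 + x)⁻¹ - (a + x)⁻¹) x := by
  have h1 := ((hasDerivAt_id x).const_add 1).log (by simp; positivity)
  have h2 := ((hasDerivAt_id x).const_add a).log (by simp; positivity)
  exact (h1.sub h2).congr_deriv (by simp)

theorem tendsto_log_sub_log {a : ℝ} :
    Tendsto (fun s => Real.log (1 + s) - Real.log (a + s)) atTop (𝓝 0) := by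
  have h1 := Real.tendsto_log_comp_add_sub_log 1
  have h2 := Real.tendsto_log_comp_add_sub_log a
  have := h1.sub h2
  simp only [sub_zero] at this
  refine this.congr fun s => ?_
  rw [add_comm s 1, add_comm s a]; ring

theorem integrableOn_inv_sub_inv {a : ℝ} (ha : 0 < a) :
    IntegrableOn (fun s : ℝ => (1 + s)⁻¹ - (a + s)⁻¹) (Ioi 0) := by
  have h := (integrableOn_inv_mul_inv (a := 1) (b := a) one_pos ha).const_mul (a - 1)
  refine IntegrableOn.congr_fun h (fun t ht => ?_) measurableSet_Ioi
  have ht' : (0 : ℝ) < t := ht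
  have h1 : 1 + t ≠ 0 := by positivity
  have h2 : a + t ≠ 0 := by positivity
  field_simp
  ring

theorem integral_inv_sub_inv {a : ℝ} (ha : 0 < a) :
    ∫ s in Ioi (0 : ℝ), ((1 + s)⁻¹ - (a + s)⁻¹) = Real.log a := by
  rw [integral_Ioi_of_hasDerivAt_of_tendsto' (fun x hx => hasDerivAt_log_sub_log ha hx)
    (integrableOn_inv_sub_inv ha) tendsto_log_sub_log]
  simp

end Scalar

variable {n m : Type*} [Fintype n] [DecidableEq n] [Fintype m] [DecidableEq m]

/-! ### The BKM form and the logarithm in an eigenbasis. -/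

section Diagonalization

theorem smul_one_eq_conj {U : Matrix n n ℂ} (h : U * Uᴴ = 1) (s : ℝ) :
    (s • (1 : Matrix n n ℂ)) = U * Matrix.diagonal (fun _ => (s : ℂ)) * Uᴴ := by
  have : Matrix.diagonal (fun _ : n => (s : ℂ)) = s • (1 : Matrix n n ℂ) := by
    ext i j; by_cases hij : i = j <;> simp [Matrix.diagonal, hij]
  rw [this]; simp [h]

/-- A unitary diagonalization of a matrix. -/
structure IsDiag (σ U : Matrix n n ℂ) (d : n → ℝ) : Prop where
  left : Uᴴ * U = 1
  right : U * Uᴴ = 1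
  eq : σ = U * Matrix.diagonal (fun i => (d i : ℂ)) * Uᴴ

theorem exists_isDiag {σ : Matrix n n ℂ} (hσ : σ.IsHermitian) :
    ∃ (U : Matrix n n ℂ) (d : n → ℝ), IsDiag σ U d ∧
      (∀ f : ℝ → ℝ, IsDiag (cfc f σ) U (fun i => f (d i))) ∧ (σ.PosDef → ∀ i, 0 < d i) := by
  have hl : (hσ.eigenvectorUnitary : Matrix n n ℂ)ᴴ * hσ.eigenvectorUnitary = 1 :=
    Unitary.coe_star_mul_self hσ.eigenvectorUnitary
  have hr : (hσ.eigenvectorUnitary : Matrix n n ℂ) * (hσ.eigenvectorUnitary : Matrix n n ℂ)ᴴ = 1 :=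
    Unitary.coe_mul_star_self hσ.eigenvectorUnitary
  refine ⟨hσ.eigenvectorUnitary, hσ.eigenvalues, ⟨hl, hr, ?_⟩, fun f => ⟨hl, hr, ?_⟩,
    fun h i => h.eigenvalues_pos i⟩
  · conv_lhs => rw [hσ.spectral_theorem]
    rfl
  · rw [hσ.cfc_eq f]
    rfl

variable {σ U : Matrix n n ℂ} {d : n → ℝ}

theorem IsDiag.resolvent (h : IsDiag σ U d) (hd : ∀ i, 0 < d i) {s : ℝ} (hs : 0 ≤ s) :
    (σ + s • (1 : Matrix n n ℂ))⁻¹ =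
      U * Matrix.diagonal (fun i => (((d i + s)⁻¹ : ℝ) : ℂ)) * Uᴴ := by
  apply Matrix.inv_eq_right_inv
  rw [smul_one_eq_conj h.right s, h.eq, ← add_mul, ← mul_add, Matrix.diagonal_add]
  have : ∀ A B : Matrix n n ℂ, U * A * Uᴴ * (U * B * Uᴴ) = U * (A * B) * Uᴴ := by
    intro A B
    simp only [Matrix.mul_assoc]
    rw [← Matrix.mul_assoc Uᴴ U, h.left, Matrix.one_mul]
  rw [this, Matrix.diagonal_mul_diagonal]
  have h2 : (fun i => ((d i : ℂ) + s) * (((d i + s)⁻¹ : ℝ) : ℂ)) = fun _ => 1 := by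
    ext i
    have : d i + s ≠ 0 := by have := hd i; positivity
    rw [← Complex.ofReal_add, ← Complex.ofReal_mul, mul_inv_cancel₀ this, Complex.ofReal_one]
  rw [h2, Matrix.diagonal_one, Matrix.mul_one, h.right]

theorem trace_conj_mul_conj (U A B : Matrix n n ℂ) :
    (A * (U * B * Uᴴ)).trace = (Uᴴ * A * U * B).trace := by
  rw [← Matrix.mul_assoc, Matrix.trace_mul_comm]
  simp only [Matrix.mul_assoc]

theorem trace_mul_resolvent (h : IsDiag σ U d) (hd : ∀ i, 0 < d i) (A B : Matrix n n ℂ)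
    {s : ℝ} (hs : 0 ≤ s) :
    (Aᴴ * (σ + s • (1 : Matrix n n ℂ))⁻¹ * B * (σ + s • (1 : Matrix n n ℂ))⁻¹).trace.re =
      ∑ i, ∑ j, (star ((Uᴴ * A * U) i j) * (Uᴴ * B * U) i j).re *
        ((d i + s)⁻¹ * (d j + s)⁻¹) := by
  rw [h.resolvent hd hs]
  set D := Matrix.diagonal (fun i => (((d i + s)⁻¹ : ℝ) : ℂ))
  have h1 : (Aᴴ * (U * D * Uᴴ) * B * (U * D * Uᴴ)).trace =
      ((Uᴴ * A * U)ᴴ * D * (Uᴴ * B * U) * D).trace := by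
    rw [trace_conj_mul_conj]
    simp only [Matrix.conjTranspose_mul, Matrix.conjTranspose_conjTranspose, Matrix.mul_assoc]
  rw [h1, Matrix.trace, Complex.re_sum, Finset.sum_comm]
  refine Finset.sum_congr rfl fun j _ => ?_
  rw [Matrix.diag_apply, Matrix.mul_diagonal, Matrix.mul_apply, Finset.sum_mul, Complex.re_sum]
  refine Finset.sum_congr rfl fun i _ => ?_
  rw [Matrix.mul_diagonal, Matrix.conjTranspose_apply, mul_right_comm (star _), mul_assoc (star _ * _),
    ← Complex.ofReal_mul, Complex.re_mul_ofReal]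

/-- The real part of the sesquilinear form of the BKM metric. -/
def bkmForm (σ A B : Matrix n n ℂ) : ℝ :=
  ∫ s in Ioi (0 : ℝ),
    (Aᴴ * (σ + s • (1 : Matrix n n ℂ))⁻¹ * B * (σ + s • (1 : Matrix n n ℂ))⁻¹).trace.re

theorem bkmMetric_eq_bkmForm (σ A : Matrix n n ℂ) : bkmMetric σ A = bkmForm σ A A := rfl

theorem integrableOn_bkmForm (hσ : σ.PosDef) (A B : Matrix n n ℂ) :
    IntegrableOn (fun s : ℝ => (Aᴴ * (σ + s • (1 : Matrix n n ℂ))⁻¹ * B *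
      (σ + s • (1 : Matrix n n ℂ))⁻¹).trace.re) (Ioi 0) := by
  obtain ⟨U, d, h, -, hd⟩ := exists_isDiag hσ.1
  replace hd := hd hσ
  refine IntegrableOn.congr_fun ?_ (fun s hs => (trace_mul_resolvent h hd A B (le_of_lt hs)).symm)
    measurableSet_Ioi
  exact integrable_finsetSum _ fun i _ => integrable_finsetSum _ fun j _ =>
    (integrableOn_inv_mul_inv (hd i) (hd j)).const_mul _

theorem bkmForm_eq_sum (h : IsDiag σ U d) (hd : ∀ i, 0 < d i) (A B : Matrix n n ℂ) :
    bkmForm σ A B = ∑ i, ∑ j, (star ((Uᴴ * A * U) i j) * (Uᴴ * B * U) i j).re *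
        invLogMean (d i) (d j) := by
  rw [bkmForm, setIntegral_congr_fun measurableSet_Ioi
    (fun s hs => trace_mul_resolvent h hd A B (le_of_lt hs))]
  have hi : ∀ i j, IntegrableOn (fun s : ℝ => (star ((Uᴴ * A * U) i j) * (Uᴴ * B * U) i j).re *
        ((d i + s)⁻¹ * (d j + s)⁻¹)) (Ioi 0) := fun i j =>
    (integrableOn_inv_mul_inv (hd i) (hd j)).const_mul _
  rw [integral_finsetSum _ fun i _ => integrable_finsetSum _ fun j _ => hi i j]
  refine Finset.sum_congr rfl fun i _ => ?_
  rw [integral_finsetSum _ fun j _ => hi i j]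
  exact Finset.sum_congr rfl fun j _ => integral_const_mul _ _

/-- In the eigenbasis only diagonal entries survive, and there the reciprocal logarithmic mean of d
and d is 1/d, which cancels the eigenvalue. -/
theorem bkmForm_self_right (hσ : σ.PosDef) (A : Matrix n n ℂ) :
    bkmForm σ A σ = A.trace.re := by
  obtain ⟨U, d, h, -, hd⟩ := exists_isDiag hσ.1
  replace hd := hd hσ
  rw [bkmForm_eq_sum h hd]
  have h1 : Uᴴ * σ * U = Matrix.diagonal (fun i => (d i : ℂ)) := by
    conv_lhs => rw [h.eq]
    simp only [Matrix.mul_assoc, h.left, Matrix.mul_one]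
    rw [← Matrix.mul_assoc, h.left, Matrix.one_mul]
  have h2 : A.trace = (Uᴴ * A * U).trace := by
    rw [Matrix.trace_mul_comm, ← Matrix.mul_assoc, h.right, Matrix.one_mul]
  rw [h1, h2, Matrix.trace, Complex.re_sum]
  refine Finset.sum_congr rfl fun i _ => ?_
  rw [Finset.sum_eq_single i (fun j _ hj => by simp [Matrix.diagonal_apply_ne' _ hj]) (by simp),
    invLogMean_self (hd i), Matrix.diagonal_apply_eq, Complex.re_mul_ofReal, mul_assoc,
    mul_inv_cancel₀ (hd i).ne', mul_one]
  simp

/-- The two terms need not be integrable separately, so they are kept together; the first does not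
involve σ and disappears when two logarithms are compared. -/
theorem trace_mul_log (hσ : σ.PosDef) (B : Matrix n n ℂ) :
    IntegrableOn (fun s : ℝ => (1 + s)⁻¹ * B.trace.re -
      (B * (σ + s • (1 : Matrix n n ℂ))⁻¹).trace.re) (Ioi 0) ∧
    (B * CFC.log σ).trace.re = ∫ s in Ioi (0 : ℝ), ((1 + s)⁻¹ * B.trace.re -
      (B * (σ + s • (1 : Matrix n n ℂ))⁻¹).trace.re) := by
  obtain ⟨U, d, h, hf, hd⟩ := exists_isDiag hσ.1
  replace hd := hd hσ
  have key : ∀ f : n → ℝ, (B * (U * Matrix.diagonal (fun i => (f i : ℂ)) * Uᴴ)).trace.re =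
      ∑ i, ((Uᴴ * B * U) i i).re * f i := by
    intro f
    rw [trace_conj_mul_conj, Matrix.trace, Complex.re_sum]
    refine Finset.sum_congr rfl fun i _ => ?_
    rw [Matrix.diag_apply, Matrix.mul_diagonal, Complex.re_mul_ofReal]
  have htr : B.trace.re = ∑ i, ((Uᴴ * B * U) i i).re := by
    have : B.trace = (Uᴴ * B * U).trace := by
      rw [Matrix.trace_mul_comm, ← Matrix.mul_assoc, h.right, Matrix.one_mul]
    rw [this, Matrix.trace, Complex.re_sum]; rfl
  have hI : ∀ s ∈ Ioi (0 : ℝ), (1 + s)⁻¹ * B.trace.re -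
      (B * (σ + s • (1 : Matrix n n ℂ))⁻¹).trace.re =
      ∑ i, ((Uᴴ * B * U) i i).re * ((1 + s)⁻¹ - (d i + s)⁻¹) := by
    intro s hs
    rw [h.resolvent hd (le_of_lt hs), key, htr, Finset.mul_sum, ← Finset.sum_sub_distrib]
    exact Finset.sum_congr rfl fun i _ => by ring
  have hi : ∀ i, IntegrableOn (fun s : ℝ => ((Uᴴ * B * U) i i).re *
      ((1 + s)⁻¹ - (d i + s)⁻¹)) (Ioi 0) := fun i =>
    (integrableOn_inv_sub_inv (hd i)).const_mul _
  refine ⟨IntegrableOn.congr_fun (integrable_finsetSum _ fun i _ => hi i)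
    (fun s hs => (hI s hs).symm) measurableSet_Ioi, ?_⟩
  rw [setIntegral_congr_fun measurableSet_Ioi hI, integral_finsetSum _ fun i _ => hi i,
    CFC.log, (hf Real.log).eq, key]
  refine Finset.sum_congr rfl fun i _ => ?_
  rw [integral_const_mul, integral_inv_sub_inv (hd i)]

end Diagonalization

/-! ### Two-positivity and the traced Kadison–Schwarz inequality. -/

section Channel

theorem exists_eq_star_mul_self {A : Type*} [NonUnitalCStarAlgebra A] [PartialOrder A]
    [StarOrderedRing A] {a : A} (h : 0 ≤ a) : ∃ b, a = star b * b :=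
  CStarAlgebra.nonneg_iff_eq_star_mul_self.1 h

theorem Channel.two_positive (Φ : Channel n m) (A : Fin 2 → Matrix n n ℂ) :
    ∃ K : Fin 2 → Fin 2 → Matrix m m ℂ, ∀ i j, Φ ((A i)ᴴ * A j) = ∑ k, (K k i)ᴴ * K k j := by
  -- With first row A and second row zero, star N * N is the Gram block matrix of A; its image under
  -- the amplified map is positive, hence factors again.
  let N : CStarMatrix (Fin 2) (Fin 2) (Matrix n n ℂ) :=
    CStarMatrix.ofMatrix (fun i j => if i = 0 then A j else 0)
  have h := Φ.toCP.map_cstarMatrix_nonneg (star N * N) (star_mul_self_nonneg N)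
  obtain ⟨K, hK⟩ := exists_eq_star_mul_self h
  refine ⟨fun k i => K k i, fun i j => ?_⟩
  have hij := congrFun (congrFun hK i) j
  rw [CStarMatrix.map_apply, CStarMatrix.mul_apply, CStarMatrix.mul_apply] at hij
  simp only [Fin.sum_univ_two, CStarMatrix.star_apply, Matrix.star_eq_conjTranspose] at hij ⊢
  have h0 : ∀ j, N 0 j = A j := fun _ => rfl
  have h1 : ∀ j, N 1 j = 0 := fun _ => rfl
  rw [← hij, h0, h0, h1, h1, Matrix.mul_zero, add_zero]

theorem Channel.map_conjTranspose (Φ : Channel n m) (A : Matrix n n ℂ) : Φ Aᴴ = (Φ A)ᴴ := by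
  obtain ⟨K, hK⟩ := Φ.two_positive ![1, A]
  have h1 := hK 0 1
  have h2 := hK 1 0
  simp only [Matrix.cons_val_zero, Matrix.cons_val_one, Matrix.conjTranspose_one, Matrix.one_mul,
    Matrix.mul_one] at h1 h2
  rw [h1, h2, Matrix.conjTranspose_sum]
  simp

theorem Channel.exists_adjoint (Φ : Channel n m) (Y : Matrix m m ℂ) :
    ∃ X : Matrix n n ℂ, ∀ A, (Xᴴ * A).trace = (Yᴴ * Φ A).trace := by
  refine ⟨Matrix.of fun i j => star (Yᴴ * Φ (Matrix.single i j 1)).trace, fun A => ?_⟩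
  have hA : Φ A = ∑ i, ∑ j, A i j • Φ (Matrix.single i j 1) := by
    conv_lhs => rw [Matrix.matrix_eq_sum_single A]
    rw [map_sum]
    refine Finset.sum_congr rfl fun i _ => ?_
    rw [map_sum]
    refine Finset.sum_congr rfl fun j _ => ?_
    rw [← map_smul, Matrix.smul_single, smul_eq_mul, mul_one]
  rw [hA, Matrix.trace]
  simp only [Matrix.mul_sum, Matrix.trace_sum, Matrix.diag_apply, Matrix.mul_apply,
    Matrix.conjTranspose_apply, Matrix.of_apply, star_star, Matrix.mul_smul, Matrix.trace_smul,
    smul_eq_mul]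
  rw [Finset.sum_comm]
  exact Finset.sum_congr rfl fun i _ => Finset.sum_congr rfl fun j _ => mul_comm _ _

/-- Here X is the adjoint image of Y. Two-positivity for the pair (SX, S) with ρ = S*S supplies K,
and the sum of tr |K_{k0} − K_{k1}Y|² is nonnegative. The pure X term, by trace preservation, and
both cross terms, by adjointness, have real part Re tr(X*ρX), so one copy is left with a minus sign.
-/
theorem Channel.kadison_schwarz (Φ : Channel n m) {X : Matrix n n ℂ} {Y : Matrix m m ℂ}
    (h : ∀ A, (Xᴴ * A).trace = (Yᴴ * Φ A).trace) {ρ : Matrix n n ℂ} (hρ : ρ.PosSemidef) :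
    (Xᴴ * ρ * X).trace.re ≤ (Yᴴ * Φ ρ * Y).trace.re := by
  obtain ⟨S, rfl⟩ := (CStarAlgebra.nonneg_iff_eq_star_mul_self).1 hρ.nonneg
  simp only [Matrix.star_eq_conjTranspose]
  obtain ⟨K, hK⟩ := Φ.two_positive ![S * X, S]
  have h00 := hK 0 0
  have h01 := hK 0 1
  have h10 := hK 1 0
  have h11 := hK 1 1
  simp only [Matrix.cons_val_zero, Matrix.cons_val_one, Fin.sum_univ_two, Matrix.conjTranspose_mul]
    at h00 h01 h10 h11
  have hpos : ∀ k, 0 ≤ ((K k 0 - K k 1 * Y)ᴴ * (K k 0 - K k 1 * Y)).trace.re := fun k =>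
    (Complex.le_def.1 (Matrix.posSemidef_conjTranspose_mul_self _).trace_nonneg).1
  have hsum : ∑ k, ((K k 0 - K k 1 * Y)ᴴ * (K k 0 - K k 1 * Y)) =
      Φ (Xᴴ * Sᴴ * (S * X)) - Φ (Xᴴ * Sᴴ * S) * Y - Yᴴ * Φ (Sᴴ * (S * X)) +
        Yᴴ * Φ (Sᴴ * S) * Y := by
    rw [h00, h01, h10, h11, Fin.sum_univ_two]
    simp only [Matrix.conjTranspose_sub, Matrix.conjTranspose_mul]
    noncomm_ring
  have h1 : (Φ (Xᴴ * Sᴴ * (S * X))).trace = (Xᴴ * (Sᴴ * S) * X).trace := by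
    rw [Φ.trace_map]; simp only [Matrix.mul_assoc]
  have h2 : (Yᴴ * Φ (Sᴴ * (S * X))).trace = (Xᴴ * (Sᴴ * S) * X).trace := by
    rw [← h]; simp only [Matrix.mul_assoc]
  have h3 : (Φ (Xᴴ * Sᴴ * S) * Y).trace.re = (Xᴴ * (Sᴴ * S) * X).trace.re := by
    rw [← h2]
    have : Φ (Xᴴ * Sᴴ * S) * Y = (Yᴴ * Φ (Sᴴ * (S * X)))ᴴ := by
      rw [Matrix.conjTranspose_mul, ← Φ.map_conjTranspose]
      simp [Matrix.mul_assoc]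
    rw [this, Matrix.trace_conjTranspose]
    simp
  have := Finset.sum_nonneg fun k (_ : k ∈ Finset.univ) => hpos k
  rw [← Complex.re_sum, ← Matrix.trace_sum, hsum, Matrix.trace_add, Matrix.trace_sub,
    Matrix.trace_sub, h1, h2, Complex.add_re, Complex.sub_re, Complex.sub_re, h3] at this
  linarith

theorem Channel.adjoint_conjTranspose (Φ : Channel n m) {X : Matrix n n ℂ} {Y : Matrix m m ℂ}
    (h : ∀ A, (Xᴴ * A).trace = (Yᴴ * Φ A).trace) (A : Matrix n n ℂ) :
    (Xᴴᴴ * A).trace = (Yᴴᴴ * Φ A).trace := by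
  have := congrArg star (h Aᴴ)
  rw [← Matrix.trace_conjTranspose, ← Matrix.trace_conjTranspose, Φ.map_conjTranspose,
    Matrix.conjTranspose_mul, Matrix.conjTranspose_mul, Matrix.conjTranspose_conjTranspose,
    Matrix.conjTranspose_conjTranspose, Matrix.conjTranspose_conjTranspose, Matrix.trace_mul_comm,
    Matrix.trace_mul_comm _ Yᴴᴴ] at this
  rw [← this, Matrix.conjTranspose_conjTranspose]

end Channel

/-! ### Variational formula for the metric. -/

section Variational

/-- The concave functional of `X` whose maximum is `⟨A, (L_σ + t R_σ)⁻¹ A⟩`, where `L_σ` and `R_σ`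
are the left and right multiplications by `σ`. -/
def variational (σ A : Matrix n n ℂ) (t : ℝ) (X : Matrix n n ℂ) : ℝ :=
  2 * (Xᴴ * A).trace.re - (Xᴴ * σ * X).trace.re - t * (X * σ * Xᴴ).trace.re

variable {σ U : Matrix n n ℂ} {d : n → ℝ}

theorem variational_eq (h : IsDiag σ U d) (A : Matrix n n ℂ) (t : ℝ) (X : Matrix n n ℂ) :
    variational σ A t X = ∑ i, ∑ j, (2 * (star ((Uᴴ * X * U) i j) * (Uᴴ * A * U) i j).re -
      (d i + t * d j) * Complex.normSq ((Uᴴ * X * U) i j)) := by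
  set D := Matrix.diagonal (fun i => (d i : ℂ))
  have hconj : ∀ B : Matrix n n ℂ, B.trace = (Uᴴ * B * U).trace := fun B => by
    rw [Matrix.trace_mul_comm, ← Matrix.mul_assoc, h.right, Matrix.one_mul]
  have hmul : ∀ B C : Matrix n n ℂ, Uᴴ * (B * C) * U = (Uᴴ * B * U) * (Uᴴ * C * U) := by
    intro B C
    have : (Uᴴ * B * U) * (Uᴴ * C * U) = Uᴴ * B * (U * Uᴴ) * C * U := by
      simp only [Matrix.mul_assoc]
    rw [this, h.right]
    simp only [Matrix.mul_assoc, Matrix.one_mul]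
  have hstar : Uᴴ * Xᴴ * U = (Uᴴ * X * U)ᴴ := by
    simp only [Matrix.conjTranspose_mul, Matrix.conjTranspose_conjTranspose, Matrix.mul_assoc]
  have hσ : Uᴴ * σ * U = D := by
    rw [h.eq]
    have : Uᴴ * (U * D * Uᴴ) * U = (Uᴴ * U) * D * (Uᴴ * U) := by simp only [Matrix.mul_assoc]
    rw [this, h.left, Matrix.one_mul, Matrix.mul_one]
  rw [variational, hconj (Xᴴ * A), hconj (Xᴴ * σ * X), hconj (X * σ * Xᴴ), hmul, hmul (Xᴴ * σ),
    hmul Xᴴ, hmul (X * σ), hmul X, hstar, hσ]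
  set X' := Uᴴ * X * U
  set A' := Uᴴ * A * U
  have e1 : (X'ᴴ * A').trace.re = ∑ i, ∑ j, (star (X' i j) * A' i j).re := by
    rw [Finset.sum_comm, Matrix.trace, Complex.re_sum]
    refine Finset.sum_congr rfl fun j _ => ?_
    rw [Matrix.diag_apply, Matrix.mul_apply, Complex.re_sum]
    rfl
  have e2 : (X'ᴴ * D * X').trace.re = ∑ i, ∑ j, d i * Complex.normSq (X' i j) := by
    rw [Finset.sum_comm, Matrix.trace, Complex.re_sum]
    refine Finset.sum_congr rfl fun j _ => ?_
    rw [Matrix.diag_apply, Matrix.mul_apply, Complex.re_sum]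
    refine Finset.sum_congr rfl fun i _ => ?_
    rw [Matrix.mul_diagonal, Matrix.conjTranspose_apply, mul_right_comm, Complex.re_mul_ofReal,
      Complex.star_def, ← Complex.normSq_eq_conj_mul_self, Complex.ofReal_re, mul_comm]
  have e3 : (X' * D * X'ᴴ).trace.re = ∑ i, ∑ j, d j * Complex.normSq (X' i j) := by
    rw [Matrix.trace, Complex.re_sum]
    refine Finset.sum_congr rfl fun i _ => ?_
    rw [Matrix.diag_apply, Matrix.mul_apply, Complex.re_sum]
    refine Finset.sum_congr rfl fun j _ => ?_
    rw [Matrix.mul_diagonal, Matrix.conjTranspose_apply, mul_right_comm, Complex.re_mul_ofReal,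
      Complex.star_def, Complex.mul_conj, Complex.ofReal_re, mul_comm]
  rw [e1, e2, e3]
  simp only [Finset.mul_sum, ← Finset.sum_sub_distrib]
  refine Finset.sum_congr rfl fun i _ => Finset.sum_congr rfl fun j _ => ?_
  ring

/-- The functional decouples over entries into 2 Re(x̄a) − c|x|² with c = d_i + t d_j > 0; complete
the square. -/
theorem variational_le (h : IsDiag σ U d) (hd : ∀ i, 0 < d i) (A : Matrix n n ℂ) {t : ℝ}
    (ht : 0 ≤ t) (X : Matrix n n ℂ) :
    variational σ A t X ≤
      ∑ i, ∑ j, Complex.normSq ((Uᴴ * A * U) i j) * (d i + t * d j)⁻¹ := by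
  rw [variational_eq h]
  refine Finset.sum_le_sum fun i _ => Finset.sum_le_sum fun j _ => ?_
  generalize (Uᴴ * X * U) i j = x
  generalize (Uᴴ * A * U) i j = a
  have hc : 0 < d i + t * d j := by have := hd i; have := hd j; positivity
  generalize d i + t * d j = c at hc
  rw [← div_eq_mul_inv, le_div_iff₀ hc]
  simp only [Complex.normSq_apply, Complex.star_def, Complex.mul_re, Complex.conj_re,
    Complex.conj_im]
  nlinarith [sq_nonneg (c * x.re - a.re), sq_nonneg (c * x.im - a.im)]

theorem exists_variational_eq (h : IsDiag σ U d) (hd : ∀ i, 0 < d i) (A : Matrix n n ℂ) {t : ℝ}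
    (ht : 0 ≤ t) : ∃ X, variational σ A t X =
      ∑ i, ∑ j, Complex.normSq ((Uᴴ * A * U) i j) * (d i + t * d j)⁻¹ := by
  -- The entrywise maximizer x = a/c.
  let X' : Matrix n n ℂ := fun i j => (Uᴴ * A * U) i j * (((d i + t * d j)⁻¹ : ℝ) : ℂ)
  refine ⟨U * X' * Uᴴ, ?_⟩
  have hX : Uᴴ * (U * X' * Uᴴ) * U = X' := by
    have : Uᴴ * (U * X' * Uᴴ) * U = (Uᴴ * U) * X' * (Uᴴ * U) := by simp only [Matrix.mul_assoc]
    rw [this, h.left, Matrix.one_mul, Matrix.mul_one]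
  rw [variational_eq h, hX]
  refine Finset.sum_congr rfl fun i _ => Finset.sum_congr rfl fun j _ => ?_
  have hc : 0 < d i + t * d j := by have := hd i; have := hd j; positivity
  simp only [X']
  generalize (Uᴴ * A * U) i j = a
  generalize d i + t * d j = c at hc
  simp only [Complex.normSq_apply, Complex.star_def, Complex.mul_re, Complex.conj_re, map_mul,
    Complex.conj_ofReal, Complex.mul_im, Complex.conj_im, Complex.ofReal_re, Complex.ofReal_im]
  field_simp
  ring

theorem bkmMetric_eq_integral (h : IsDiag σ U d) (hd : ∀ i, 0 < d i) (A : Matrix n n ℂ) :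
    IntegrableOn (fun t : ℝ => (1 + t)⁻¹ *
      ∑ i, ∑ j, Complex.normSq ((Uᴴ * A * U) i j) * (d i + t * d j)⁻¹) (Ioi 0) ∧
    bkmMetric σ A = ∫ t in Ioi (0 : ℝ), (1 + t)⁻¹ *
      ∑ i, ∑ j, Complex.normSq ((Uᴴ * A * U) i j) * (d i + t * d j)⁻¹ := by
  have hI : ∀ t : ℝ, (1 + t)⁻¹ *
      ∑ i, ∑ j, Complex.normSq ((Uᴴ * A * U) i j) * (d i + t * d j)⁻¹ =
      ∑ i, ∑ j, Complex.normSq ((Uᴴ * A * U) i j) * ((1 + t)⁻¹ * (d i + t * d j)⁻¹) := by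
    intro t
    simp only [Finset.mul_sum]
    exact Finset.sum_congr rfl fun i _ => Finset.sum_congr rfl fun j _ => by ring
  have hi : ∀ i j, IntegrableOn (fun t : ℝ => Complex.normSq ((Uᴴ * A * U) i j) *
      ((1 + t)⁻¹ * (d i + t * d j)⁻¹)) (Ioi 0) := fun i j =>
    (integrableOn_inv_one_add_mul_inv (hd i) (hd j)).const_mul _
  simp only [hI]
  refine ⟨integrable_finsetSum _ fun i _ => integrable_finsetSum _ fun j _ => hi i j, ?_⟩
  rw [bkmMetric_eq_bkmForm, bkmForm_eq_sum h hd,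
    integral_finsetSum _ fun i _ => integrable_finsetSum _ fun j _ => hi i j]
  refine Finset.sum_congr rfl fun i _ => ?_
  rw [integral_finsetSum _ fun j _ => hi i j]
  refine Finset.sum_congr rfl fun j _ => ?_
  rw [integral_const_mul, ← invLogMean_eq (hd j), Complex.star_def,
    ← Complex.normSq_eq_conj_mul_self, Complex.ofReal_re]

theorem bkmMetric_le_of_variational {τ : Matrix m m ℂ} (hσ : σ.PosDef) (hτ : τ.PosDef)
    {A : Matrix n n ℂ} {B : Matrix m m ℂ}
    (H : ∀ t : ℝ, 0 < t → ∀ Y, ∃ X, variational τ B t Y ≤ variational σ A t X) :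
    bkmMetric τ B ≤ bkmMetric σ A := by
  obtain ⟨U, d, h, -, hd⟩ := exists_isDiag hσ.1
  replace hd := hd hσ
  obtain ⟨V, e, h', -, he⟩ := exists_isDiag hτ.1
  replace he := he hτ
  obtain ⟨i1, e1⟩ := bkmMetric_eq_integral h hd A
  obtain ⟨i2, e2⟩ := bkmMetric_eq_integral h' he B
  rw [e1, e2]
  refine setIntegral_mono_on i2 i1 measurableSet_Ioi fun t ht => ?_
  have ht' : (0 : ℝ) < t := ht
  gcongr ?_ * ?_
  obtain ⟨Y, hY⟩ := exists_variational_eq h' he B ht'.le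
  obtain ⟨X, hX⟩ := H t ht' Y
  rw [← hY]
  exact hX.trans (variational_le h hd A ht'.le X)

/-- Take X to be the adjoint image of Y: the linear term is unchanged, and Kadison–Schwarz for Y and
for Y* controls the left and right quadratic terms. -/
theorem Channel.exists_variational_le (Φ : Channel n m) {ρ : Matrix n n ℂ} (hρ : ρ.PosSemidef)
    (A : Matrix n n ℂ) {t : ℝ} (ht : 0 ≤ t) (Y : Matrix m m ℂ) :
    ∃ X, variational (Φ ρ) (Φ A) t Y ≤ variational ρ A t X := by
  obtain ⟨X, hX⟩ := Φ.exists_adjoint Y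
  refine ⟨X, ?_⟩
  have h1 := Φ.kadison_schwarz hX hρ
  have h2 := Φ.kadison_schwarz (Φ.adjoint_conjTranspose hX) hρ
  simp only [Matrix.conjTranspose_conjTranspose] at h2
  rw [variational, variational, hX A]
  have := mul_le_mul_of_nonneg_left h2 ht
  linarith

end Variational

/-! ### Uniform resolvent bounds and differentiation of the logarithm along a path. -/

section Path

theorem posDef_smul_one {c : ℝ} (hc : 0 < c) : (c • (1 : Matrix n n ℂ)).PosDef :=
  Matrix.PosDef.one.smul hc

theorem posDef_of_smul_one_le {σ : Matrix n n ℂ} {c : ℝ} (hc : 0 < c)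
    (h : c • (1 : Matrix n n ℂ) ≤ σ) : σ.PosDef := by
  have := (posDef_smul_one (n := n) hc).add_posSemidef (Matrix.le_iff.1 h)
  simpa using this

theorem inv_smul_one {c : ℝ} (hc : c ≠ 0) :
    (c • (1 : Matrix n n ℂ))⁻¹ = c⁻¹ • (1 : Matrix n n ℂ) := by
  apply Matrix.inv_eq_right_inv
  simp [hc]

theorem inv_le_inv_of_le {σ τ : Matrix n n ℂ} (hσ : σ.PosDef) (h : σ ≤ τ) : τ⁻¹ ≤ σ⁻¹ := by
  rw [Matrix.nonsing_inv_eq_ringInverse, Matrix.nonsing_inv_eq_ringInverse]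
  exact CStarAlgebra.ringInverse_le_ringInverse h (Matrix.isStrictlyPositive_iff_posDef.2 hσ)

theorem le_smul_one_of_norm_le {σ : Matrix n n ℂ} (hσ : σ.PosSemidef) {c : ℝ} (hc : 0 ≤ c) :
    ‖σ‖ ≤ c ↔ σ ≤ c • (1 : Matrix n n ℂ) := by
  rw [CStarAlgebra.norm_le_iff_le_algebraMap σ hc hσ.nonneg, Algebra.algebraMap_eq_smul_one]

theorem norm_resolvent_le {σ : Matrix n n ℂ} {c : ℝ} (hc : 0 < c)
    (h : c • (1 : Matrix n n ℂ) ≤ σ) {s : ℝ} (hs : 0 ≤ s) :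
    ‖(σ + s • (1 : Matrix n n ℂ))⁻¹‖ ≤ (c + s)⁻¹ := by
  have h1 : (c + s) • (1 : Matrix n n ℂ) ≤ σ + s • (1 : Matrix n n ℂ) := by
    rw [add_smul]; gcongr
  have hcs : 0 < c + s := by positivity
  have h2 := inv_le_inv_of_le (posDef_smul_one hcs) h1
  rw [inv_smul_one hcs.ne'] at h2
  exact (le_smul_one_of_norm_le (posDef_of_smul_one_le hcs h1).inv.posSemidef (by positivity)).2 h2

theorem isUnit_add_smul_one {σ : Matrix n n ℂ} (hσ : σ.PosDef) {s : ℝ} (hs : 0 ≤ s) :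
    IsUnit (σ + s • (1 : Matrix n n ℂ)) :=
  (hσ.add_posSemidef (Matrix.PosSemidef.one.smul hs)).isUnit

theorem continuousAt_inv {σ : Matrix n n ℂ} (hσ : IsUnit σ) :
    ContinuousAt (fun τ : Matrix n n ℂ => τ⁻¹) σ := by
  obtain ⟨u, rfl⟩ := hσ
  have := NormedRing.inverse_continuousAt u
  refine this.congr (.of_forall fun τ => ?_)
  exact (Matrix.nonsing_inv_eq_ringInverse τ).symm

theorem continuousOn_resolvent {T : Set ℝ} {σ : ℝ → Matrix n n ℂ} (hσ : ContinuousOn σ T)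
    (hpos : ∀ θ ∈ T, (σ θ).PosDef) :
    ContinuousOn (fun p : ℝ × ℝ => (σ p.1 + p.2 • (1 : Matrix n n ℂ))⁻¹) (T ×ˢ Ici 0) := by
  intro p hp
  have h1 : ContinuousWithinAt (fun p : ℝ × ℝ => σ p.1 + p.2 • (1 : Matrix n n ℂ))
      (T ×ˢ Ici 0) p := by
    have := hσ.comp (continuousOn_fst (s := T ×ˢ Ici (0 : ℝ))) (fun q hq => hq.1)
    exact (this.add (by fun_prop)) p hp
  exact ContinuousAt.comp_continuousWithinAt (g := fun τ : Matrix n n ℂ => τ⁻¹)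
    (continuousAt_inv (isUnit_add_smul_one (hpos _ hp.1) hp.2)) h1

/-- Bounding the norm of the continuous inverse on a compact set avoids any discussion of continuity
of eigenvalues. -/
theorem exists_uniform_lower_bound {T : Set ℝ} (hT : IsCompact T) {σ : ℝ → Matrix n n ℂ}
    (hσ : ContinuousOn σ T) (hpos : ∀ θ ∈ T, (σ θ).PosDef) :
    ∃ c : ℝ, 0 < c ∧ ∀ θ ∈ T, c • (1 : Matrix n n ℂ) ≤ σ θ := by
  have hc : ContinuousOn (fun θ => (σ θ)⁻¹) T := fun θ hθ =>
    (continuousAt_inv (hpos θ hθ).isUnit).comp_continuousWithinAt (hσ θ hθ)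
  obtain ⟨M, hM⟩ := hT.exists_bound_of_continuousOn hc
  -- The bound M may fail to be positive, for instance when T or the index type is empty.
  have hM' : 0 < max M 1 := by positivity
  refine ⟨(max M 1)⁻¹, by positivity, fun θ hθ => ?_⟩
  have h1 := (le_smul_one_of_norm_le (hpos θ hθ).inv.posSemidef hM'.le).1
    ((hM θ hθ).trans (le_max_left _ _))
  have h2 := inv_le_inv_of_le (hpos θ hθ).inv h1
  rwa [inv_smul_one hM'.ne', Matrix.nonsing_inv_nonsing_inv _
    ((Matrix.isUnit_iff_isUnit_det _).1 (hpos θ hθ).isUnit)] at h2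

/-- The trace as a continuous linear map. -/
def traceCLM (n : Type*) [Fintype n] [DecidableEq n] : Matrix n n ℂ →L[ℂ] ℂ :=
  LinearMap.toContinuousLinearMap (Matrix.traceLinearMap n ℂ ℂ)

theorem norm_bkm_integrand_le {σ : Matrix n n ℂ} {c : ℝ} (hc : 0 < c)
    (h : c • (1 : Matrix n n ℂ) ≤ σ) (A B : Matrix n n ℂ) {s : ℝ} (hs : 0 ≤ s) :
    ‖(Aᴴ * (σ + s • (1 : Matrix n n ℂ))⁻¹ * B * (σ + s • (1 : Matrix n n ℂ))⁻¹).trace.re‖ ≤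
      ‖traceCLM n‖ * (‖A‖ * ‖B‖) * ((c + s) ^ 2)⁻¹ := by
  have hR := norm_resolvent_le hc h hs
  set R := (σ + s • (1 : Matrix n n ℂ))⁻¹
  have hcs : 0 < c + s := by positivity
  calc ‖(Aᴴ * R * B * R).trace.re‖ ≤ ‖traceCLM n (Aᴴ * R * B * R)‖ := Complex.abs_re_le_norm _
    _ ≤ ‖traceCLM n‖ * ‖Aᴴ * R * B * R‖ := ContinuousLinearMap.le_opNorm _ _
    _ ≤ ‖traceCLM n‖ * (‖A‖ * (c + s)⁻¹ * ‖B‖ * (c + s)⁻¹) := by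
      gcongr
      refine (norm_mul_le _ _).trans ?_
      gcongr
      refine (norm_mul_le _ _).trans ?_
      gcongr
      refine (norm_mul_le _ _).trans ?_
      gcongr
      exact (Matrix.l2_opNorm_conjTranspose A).le
    _ = ‖traceCLM n‖ * (‖A‖ * ‖B‖) * ((c + s) ^ 2)⁻¹ := by
      rw [sq, mul_inv]; ring

variable {T : Set ℝ} {σ A B : ℝ → Matrix n n ℂ}

theorem continuousOn_bkm_integrand (hσ : ContinuousOn σ T) (hpos : ∀ θ ∈ T, (σ θ).PosDef)
    (hA : ContinuousOn A T) (hB : ContinuousOn B T) :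
    ContinuousOn (fun p : ℝ × ℝ => ((A p.1)ᴴ * (σ p.1 + p.2 • (1 : Matrix n n ℂ))⁻¹ * B p.1 *
      (σ p.1 + p.2 • (1 : Matrix n n ℂ))⁻¹).trace.re) (T ×ˢ Ici 0) := by
  have hR := continuousOn_resolvent hσ hpos
  have hA' := hA.comp (continuousOn_fst (s := T ×ˢ Ici (0 : ℝ))) (fun q hq => hq.1)
  have hB' := hB.comp (continuousOn_fst (s := T ×ˢ Ici (0 : ℝ))) (fun q hq => hq.1)
  exact Complex.continuous_re.comp_continuousOn
    ((traceCLM n).continuous.comp_continuousOn (((hA'.star.mul hR).mul hB').mul hR))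

theorem exists_bound_bkm_integrand (hT : IsCompact T) (hσ : ContinuousOn σ T)
    (hpos : ∀ θ ∈ T, (σ θ).PosDef) (hA : ContinuousOn A T) (hB : ContinuousOn B T) :
    ∃ c K : ℝ, 0 < c ∧ ∀ θ ∈ T, ∀ s : ℝ, 0 ≤ s →
      ‖((A θ)ᴴ * (σ θ + s • (1 : Matrix n n ℂ))⁻¹ * B θ *
        (σ θ + s • (1 : Matrix n n ℂ))⁻¹).trace.re‖ ≤ K * ((c + s) ^ 2)⁻¹ := by
  obtain ⟨c, hc, hcT⟩ := exists_uniform_lower_bound hT hσ hpos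
  obtain ⟨a, ha⟩ := hT.exists_bound_of_continuousOn hA
  obtain ⟨b, hb⟩ := hT.exists_bound_of_continuousOn hB
  refine ⟨c, ‖traceCLM n‖ * (a * b), hc, fun θ hθ s hs => ?_⟩
  refine (norm_bkm_integrand_le hc (hcT θ hθ) (A θ) (B θ) hs).trans ?_
  have := (norm_nonneg _).trans (ha θ hθ)
  gcongr
  · exact ha θ hθ
  · exact hb θ hθ

theorem continuousOn_bkmForm (hT : IsCompact T) (hσ : ContinuousOn σ T)
    (hpos : ∀ θ ∈ T, (σ θ).PosDef) (hA : ContinuousOn A T) (hB : ContinuousOn B T) :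
    ContinuousOn (fun θ => bkmForm (σ θ) (A θ) (B θ)) T := by
  obtain ⟨c, K, hc, hK⟩ := exists_bound_bkm_integrand hT hσ hpos hA hB
  have hF := continuousOn_bkm_integrand hσ hpos hA hB
  refine continuousOn_of_dominated (bound := fun s => K * ((c + s) ^ 2)⁻¹) ?_ ?_
    ((integrableOn_inv_add_sq hc).const_mul K) ?_
  · exact fun θ hθ => (integrableOn_bkmForm (hpos θ hθ) _ _).aestronglyMeasurable
  · exact fun θ hθ => (ae_restrict_iff' measurableSet_Ioi).2
      (.of_forall fun s hs => hK θ hθ s (le_of_lt hs))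
  · refine (ae_restrict_iff' measurableSet_Ioi).2 (.of_forall fun s hs => ?_)
    have hs' : (0 : ℝ) ≤ s := le_of_lt hs
    exact hF.comp (f := fun θ => (θ, s)) (by fun_prop) (fun θ hθ => ⟨hθ, hs'⟩)

theorem hasDerivAt_trace_mul_resolvent {σ' : Matrix n n ℂ} (B : Matrix n n ℂ) {θ s : ℝ}
    (hσ : HasDerivAt σ σ' θ) (hpos : (σ θ).PosDef) (hs : 0 ≤ s) :
    HasDerivAt (fun θ => -(B * (σ θ + s • (1 : Matrix n n ℂ))⁻¹).trace.re)
      (B * (σ θ + s • (1 : Matrix n n ℂ))⁻¹ * σ' * (σ θ + s • (1 : Matrix n n ℂ))⁻¹).trace.re θ := by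
  obtain ⟨u, hu⟩ := isUnit_add_smul_one hpos hs
  have h1 : HasDerivAt (fun θ => σ θ + s • (1 : Matrix n n ℂ)) σ' θ := hσ.add_const _
  have h2 := hasFDerivAt_ringInverse (𝕜 := ℝ) u
  rw [hu] at h2
  have h3 := h2.comp_hasDerivAt θ h1
  have h4 := (h3.const_mul B)
  have h5 := ((Complex.reCLM.comp ((traceCLM n).restrictScalars ℝ)).hasFDerivAt.comp_hasDerivAt θ
    h4).fun_neg
  have hui : (↑u⁻¹ : Matrix n n ℂ) = (σ θ + s • (1 : Matrix n n ℂ))⁻¹ := by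
    rw [← hu, Matrix.nonsing_inv_eq_ringInverse, Ring.inverse_unit]
  refine (h5.congr_deriv ?_).congr_of_eventuallyEq (.of_forall fun t => ?_)
  · rw [hui]
    change -(B * -((σ θ + s • (1 : Matrix n n ℂ))⁻¹ * σ' *
      (σ θ + s • (1 : Matrix n n ℂ))⁻¹)).trace.re = _
    simp [Matrix.mul_assoc]
  · change -(B * (σ t + s • (1 : Matrix n n ℂ))⁻¹).trace.re =
      -(B * Ring.inverse (σ t + s • (1 : Matrix n n ℂ))).trace.re
    rw [Matrix.nonsing_inv_eq_ringInverse]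

/-- Swapping the integrals lets the fundamental theorem of calculus act on the resolvent at each
fixed s, so the logarithm itself is never differentiated. The form is conjugate-linear in its first
slot, hence `Bᴴ`. -/
theorem trace_mul_log_sub (σ' : ℝ → Matrix n n ℂ) (B : Matrix n n ℂ)
    (hσ : ContinuousOn σ (Icc 0 1)) (hpos : ∀ θ ∈ Icc (0 : ℝ) 1, (σ θ).PosDef)
    (hσ' : ContinuousOn σ' (Icc 0 1)) (hd : ∀ θ ∈ Ioo (0 : ℝ) 1, HasDerivAt σ (σ' θ) θ) :
    (B * CFC.log (σ 1)).trace.re - (B * CFC.log (σ 0)).trace.re =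
      ∫ θ in (0 : ℝ)..1, bkmForm (σ θ) Bᴴ (σ' θ) := by
  have h0 : (0 : ℝ) ∈ Icc (0 : ℝ) 1 := by simp
  have h1 : (1 : ℝ) ∈ Icc (0 : ℝ) 1 := by simp
  obtain ⟨i0, e0⟩ := trace_mul_log (hpos 0 h0) B
  obtain ⟨i1, e1⟩ := trace_mul_log (hpos 1 h1) B
  have hBc : ContinuousOn (fun _ : ℝ => Bᴴ) (Icc 0 1) := continuousOn_const
  obtain ⟨c, K, hc, hK⟩ := exists_bound_bkm_integrand isCompact_Icc hσ hpos hBc hσ'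
  have hF := continuousOn_bkm_integrand hσ hpos hBc hσ'
  simp only [Matrix.conjTranspose_conjTranspose] at hK hF
  rw [e0, e1, ← integral_sub i1 i0, intervalIntegral.integral_of_le zero_le_one]
  simp only [bkmForm, Matrix.conjTranspose_conjTranspose]
  rw [integral_integral_swap]
  · refine setIntegral_congr_fun measurableSet_Ioi fun s hs => ?_
    have hs' : (0 : ℝ) ≤ s := le_of_lt hs
    have hFs : ContinuousOn (fun θ => (B * (σ θ + s • (1 : Matrix n n ℂ))⁻¹ * σ' θ *
        (σ θ + s • (1 : Matrix n n ℂ))⁻¹).trace.re) (Icc 0 1) :=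
      hF.comp (f := fun θ => (θ, s)) (by fun_prop) (fun θ hθ => ⟨hθ, hs'⟩)
    have hR : ContinuousOn (fun θ => -(B * (σ θ + s • (1 : Matrix n n ℂ))⁻¹).trace.re)
        (Icc 0 1) := by
      have := (continuousOn_resolvent hσ hpos).comp (f := fun θ : ℝ => (θ, s))
        (t := Icc 0 1 ×ˢ Ici 0) (s := Icc 0 1) (by fun_prop) (fun θ hθ => ⟨hθ, hs'⟩)
      exact (Complex.continuous_re.comp_continuousOn
        ((traceCLM n).continuous.comp_continuousOn (continuousOn_const.mul this))).neg
    rw [← intervalIntegral.integral_of_le zero_le_one,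
      intervalIntegral.integral_eq_sub_of_hasDerivAt_of_le zero_le_one hR
        (fun θ hθ => hasDerivAt_trace_mul_resolvent B (hd θ hθ) (hpos θ (Ioo_subset_Icc_self hθ)) hs')
        (hFs.intervalIntegrable_of_Icc zero_le_one)]
    ring
  · have hsub : Ioc (0 : ℝ) 1 ×ˢ Ioi (0 : ℝ) ⊆ Icc (0 : ℝ) 1 ×ˢ Ici (0 : ℝ) :=
      prod_mono Ioc_subset_Icc_self Ioi_subset_Ici_self
    have hmeas : MeasurableSet (Ioc (0 : ℝ) 1 ×ˢ Ioi (0 : ℝ)) :=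
      measurableSet_Ioc.prod measurableSet_Ioi
    have hbd : Integrable (fun p : ℝ × ℝ => (1 : ℝ) * (K * ((c + p.2) ^ 2)⁻¹))
        ((volume.restrict (Ioc 0 1)).prod (volume.restrict (Ioi 0))) :=
      Integrable.mul_prod (f := fun _ : ℝ => (1 : ℝ)) (g := fun s : ℝ => K * ((c + s) ^ 2)⁻¹)
        (integrable_const _) ((integrableOn_inv_add_sq hc).const_mul K)
    refine hbd.mono' ?_ ?_
    · rw [Measure.prod_restrict]
      exact (hF.mono hsub).aestronglyMeasurable hmeas
    · rw [Measure.prod_restrict]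
      refine (ae_restrict_iff' hmeas).2 (.of_forall fun p hp => ?_)
      rw [one_mul]
      exact hK p.1 (hsub hp).1 p.2 (hsub hp).2

end Path

/-! ### Reduction of singular states to positive definite ones. -/

section KernelProjection

/-- `Q` is the orthogonal projection onto the kernel of `ρ`. -/
structure IsKerProj (ρ Q : Matrix n n ℂ) : Prop where
  herm : Qᴴ = Q
  idem : Q * Q = Q
  mul_eq_zero : ρ * Q = 0
  mulVec_eq : ∀ v : n → ℂ, ρ *ᵥ v = 0 → Q *ᵥ v = v

variable {ρ σ Q Q' U A B : Matrix n n ℂ} {d e : n → ℝ}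

theorem IsDiag.mul_eq (hA : IsDiag A U d) (hB : IsDiag B U e) :
    A * B = U * Matrix.diagonal (fun i => ((d i * e i : ℝ) : ℂ)) * Uᴴ := by
  have : A * B = U * Matrix.diagonal (fun i => (d i : ℂ)) * (Uᴴ * U) *
      Matrix.diagonal (fun i => (e i : ℂ)) * Uᴴ := by
    rw [hA.eq, hB.eq]; simp only [Matrix.mul_assoc]
  rw [this, hA.left, Matrix.mul_one, Matrix.mul_assoc U, Matrix.diagonal_mul_diagonal]
  simp

theorem IsKerProj.posSemidef (h : IsKerProj ρ Q) : Q.PosSemidef := by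
  have := Matrix.posSemidef_conjTranspose_mul_self Q
  rwa [h.herm, h.idem] at this

theorem IsKerProj.posDef_add (h : IsKerProj ρ Q) (hρ : ρ.PosSemidef) : (ρ + Q).PosDef := by
  refine Matrix.PosDef.of_dotProduct_mulVec_pos (hρ.add h.posSemidef).1 fun v hv => ?_
  have h1 := hρ.dotProduct_mulVec_nonneg v
  have h2 := h.posSemidef.dotProduct_mulVec_nonneg v
  rw [Matrix.add_mulVec, dotProduct_add]
  refine lt_of_le_of_ne (add_nonneg h1 h2) fun h0 => hv ?_
  have h3 := (add_eq_zero_iff_of_nonneg h1 h2).1 h0.symm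
  rw [← h.mulVec_eq v ((hρ.dotProduct_mulVec_zero_iff v).1 h3.1)]
  exact (h.posSemidef.dotProduct_mulVec_zero_iff v).1 h3.2

/-- The projection is the functional calculus of the indicator of 0. Adding it moves the eigenvalue
0 to 1, where `Real.log` also vanishes. -/
theorem exists_isKerProj (hρ : ρ.PosSemidef) :
    ∃ Q, IsKerProj ρ Q ∧ CFC.log (ρ + Q) = CFC.log ρ := by
  classical
  obtain ⟨U, d, h, hf, -⟩ := exists_isDiag hρ.1
  have hsa : IsSelfAdjoint ρ := hρ.1
  have hfin : (spectrum ℝ ρ).Finite := Matrix.finite_real_spectrum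
  have hcont : ∀ f : ℝ → ℝ, ContinuousOn f (spectrum ℝ ρ) := fun f => hfin.continuousOn f
  let χ : ℝ → ℝ := fun x => if x = 0 then 1 else 0
  have hQ := hf χ
  -- With the convention 0⁻¹ = 0, x⁻¹x is the indicator of x ≠ 0; the factor ρ on the right makes
  -- this vanish on the kernel.
  have hcompl : 1 - cfc χ ρ = cfc (fun x : ℝ => x⁻¹) ρ * ρ := by
    rw [← cfc_one ℝ ρ, ← cfc_sub _ _ ρ (hcont _) (hcont _)]
    conv_rhs => enter [2]; rw [← cfc_id' ℝ ρ]
    rw [← cfc_mul _ _ ρ (hcont _) (hcont _)]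
    refine cfc_congr fun x _ => ?_
    by_cases hx : x = 0 <;> simp [χ, hx]
  refine ⟨cfc χ ρ, ⟨?_, ?_, ?_, fun v hv => ?_⟩, ?_⟩
  · exact cfc_predicate χ ρ
  · rw [← cfc_mul _ _ ρ (hcont _) (hcont _)]
    refine cfc_congr fun x _ => ?_
    by_cases hx : x = 0 <;> simp [χ, hx]
  · rw [h.mul_eq hQ]
    have : (fun i => ((d i * χ (d i) : ℝ) : ℂ)) = fun _ => 0 := by
      ext i
      by_cases hx : d i = 0 <;> simp [χ, hx]
    rw [this, Matrix.diagonal_zero, Matrix.mul_zero, Matrix.zero_mul]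
  · have := congrArg (fun M => M *ᵥ v) hcompl
    simp only [Matrix.sub_mulVec, Matrix.one_mulVec, ← Matrix.mulVec_mulVec, hv,
      Matrix.mulVec_zero] at this
    exact (sub_eq_zero.1 this).symm
  · have h1 : ρ + cfc χ ρ = cfc (fun x => x + χ x) ρ := by
      rw [cfc_add ρ (fun x => x) χ (hcont _) (hcont _), cfc_id' ℝ ρ]
    rw [h1, CFC.log, CFC.log, ← cfc_comp' Real.log (fun x => x + χ x) ρ
      ((hfin.image _).continuousOn _) (hcont _)]
    refine cfc_congr fun x _ => ?_
    by_cases hx : x = 0 <;> simp [χ, hx]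

theorem IsKerProj.mul_right (h : IsKerProj ρ Q) (hA : ρ * A = 0) : Q * A = A := by
  ext i j
  have h1 : ρ *ᵥ (A.col j) = 0 := by
    ext k; exact congrFun (congrFun hA k) j
  exact congrFun (h.mulVec_eq _ h1) i

theorem IsKerProj.unique (h : IsKerProj ρ Q) (h' : IsKerProj ρ Q') : Q = Q' := by
  have h1 := h.mul_right h'.mul_eq_zero
  have h2 := congrArg Matrix.conjTranspose (h'.mul_right h.mul_eq_zero)
  rw [Matrix.conjTranspose_mul, h.herm, h'.herm] at h2
  rw [← h1, h2]

theorem IsKerProj.log_add (h : IsKerProj ρ Q) (hρ : ρ.PosSemidef) :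
    CFC.log (ρ + Q) = CFC.log ρ := by
  obtain ⟨Q', hQ', hlog⟩ := exists_isKerProj hρ
  rwa [h.unique hQ']

theorem mul_eq_zero_of_suppLE (h : SuppLE ρ σ) (hA : σ * A = 0) : ρ * A = 0 := by
  ext i j
  have h1 : σ *ᵥ (A.col j) = 0 := by
    ext k; exact congrFun (congrFun hA k) j
  exact congrFun (h _ h1) i

theorem IsKerProj.of_suppLE (h : IsKerProj σ Q) (h1 : SuppLE ρ σ) (h2 : SuppLE σ ρ) :
    IsKerProj ρ Q :=
  ⟨h.herm, h.idem, mul_eq_zero_of_suppLE h1 h.mul_eq_zero, fun v hv => h.mulVec_eq v (h2 v hv)⟩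

theorem IsKerProj.mul_eq_zero' (h : IsKerProj ρ Q) (hρ : ρ.PosSemidef) : Q * ρ = 0 := by
  have := congrArg Matrix.conjTranspose h.mul_eq_zero
  rwa [Matrix.conjTranspose_mul, h.herm, hρ.1.eq, Matrix.conjTranspose_zero] at this

theorem IsKerProj.compl_conj (h : IsKerProj ρ Q) (hρ : ρ.PosSemidef) :
    (1 - Q) * (ρ + Q) * (1 - Q) = ρ := by
  have h1 : (1 - Q) * (ρ + Q) = ρ := by
    rw [Matrix.sub_mul, Matrix.mul_add Q, h.idem, h.mul_eq_zero' hρ]; simp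
  rw [h1, Matrix.mul_sub, h.mul_eq_zero]; simp

theorem suppLE_of_le_smul (hρ : ρ.PosSemidef) {C : ℝ} (h : ρ ≤ C • σ) : SuppLE ρ σ := by
  intro v hv
  rw [← hρ.dotProduct_mulVec_zero_iff v]
  refine le_antisymm ?_ (hρ.dotProduct_mulVec_nonneg v)
  have := (Matrix.le_iff.1 h).dotProduct_mulVec_nonneg v
  rw [Matrix.sub_mulVec, Matrix.smul_mulVec, hv, smul_zero, zero_sub, dotProduct_neg] at this
  exact neg_nonneg.1 this

/-- Compress ρ ≤ b·1 ≤ (b/c)(σ + Q) by 1 − Q, which fixes ρ and removes Q. The explicit constant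
gives a bound uniform along a path. -/
theorem IsKerProj.le_smul (h : IsKerProj σ Q) (hρ : ρ.PosSemidef) (hσ : σ.PosSemidef)
    (hs : SuppLE ρ σ) {c b : ℝ} (hc : 0 < c) (hcσ : c • (1 : Matrix n n ℂ) ≤ σ + Q) (hb : 0 ≤ b)
    (hρb : ρ ≤ b • 1) : ρ ≤ (b * c⁻¹) • σ := by
  have hP : (1 - Q)ᴴ = 1 - Q := by rw [Matrix.conjTranspose_sub, Matrix.conjTranspose_one, h.herm]
  have h0 := mul_eq_zero_of_suppLE hs h.mul_eq_zero
  have h0' : Q * ρ = 0 := by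
    have := congrArg Matrix.conjTranspose h0
    rwa [Matrix.conjTranspose_mul, h.herm, hρ.1.eq, Matrix.conjTranspose_zero] at this
  have h1 : ρ ≤ (b * c⁻¹) • (σ + Q) := by
    calc ρ ≤ b • 1 := hρb
      _ = (b * c⁻¹) • (c • (1 : Matrix n n ℂ)) := by
        rw [smul_smul, mul_assoc, inv_mul_cancel₀ hc.ne', mul_one]
      _ ≤ _ := smul_le_smul_of_nonneg_left hcσ (by positivity)
  have h2 := (Matrix.le_iff.1 h1).mul_mul_conjTranspose_same (1 - Q)
  rw [hP, Matrix.mul_sub (1 - Q) _ ρ, Matrix.sub_mul _ _ (1 - Q), Matrix.mul_smul, Matrix.smul_mul,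
    h.compl_conj hσ] at h2
  have h3 : (1 - Q) * ρ * (1 - Q) = ρ := by
    rw [Matrix.sub_mul, h0', Matrix.one_mul, sub_zero, Matrix.mul_sub, h0]; simp
  rw [h3] at h2
  exact h2

theorem exists_le_smul (hρ : ρ.PosSemidef) (hσ : σ.PosSemidef) (hs : SuppLE ρ σ) :
    ∃ C : ℝ, 0 < C ∧ ρ ≤ C • σ := by
  obtain ⟨Q, h, -⟩ := exists_isKerProj hσ
  obtain ⟨c, hc, hcT⟩ := exists_uniform_lower_bound (T := {0}) isCompact_singleton
    (σ := fun _ => σ + Q) continuousOn_const (fun _ _ => h.posDef_add hσ)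
  have hb := (le_smul_one_of_norm_le hρ (c := ‖ρ‖ + 1) (by positivity)).1 (by simp)
  exact ⟨_, by positivity, h.le_smul hρ hσ hs hc (hcT 0 rfl) (by positivity) hb⟩

/-- The two resolvents differ only on the range of Q, which A annihilates. Positivity of s is needed
to invert ρ + s. -/
theorem mul_resolvent_add (h : IsKerProj ρ Q) (hρ : ρ.PosSemidef) (hA : A * Q = 0) {s : ℝ}
    (hs : 0 < s) : A * (ρ + Q + s • (1 : Matrix n n ℂ))⁻¹ = A * (ρ + s • (1 : Matrix n n ℂ))⁻¹ := by
  have hu1 : IsUnit (ρ + s • (1 : Matrix n n ℂ)) :=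
    ((posDef_smul_one hs).posSemidef_add hρ).isUnit
  have hu2 : IsUnit (ρ + Q + s • (1 : Matrix n n ℂ)) :=
    isUnit_add_smul_one (h.posDef_add hρ) hs.le
  rw [Matrix.isUnit_iff_isUnit_det] at hu1 hu2
  have hRQ : (ρ + s • (1 : Matrix n n ℂ))⁻¹ * Q = s⁻¹ • Q := by
    have : Q = (ρ + s • (1 : Matrix n n ℂ)) * (s⁻¹ • Q) := by
      rw [Matrix.mul_smul, Matrix.add_mul, h.mul_eq_zero]
      simp [hs.ne']
    conv_lhs => rw [this]
    rw [Matrix.nonsing_inv_mul_cancel_left _ _ hu1]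
  have h1 : A * (ρ + s • (1 : Matrix n n ℂ))⁻¹ * (ρ + Q + s • (1 : Matrix n n ℂ)) = A := by
    rw [add_right_comm, Matrix.mul_add, Matrix.mul_assoc, Matrix.nonsing_inv_mul _ hu1,
      Matrix.mul_assoc, hRQ, Matrix.mul_smul, hA]
    simp
  conv_lhs => rw [← h1]
  rw [Matrix.mul_assoc, Matrix.mul_nonsing_inv _ hu2, Matrix.mul_one]

theorem bkmMetric_add_kerProj (h : IsKerProj ρ Q) (hρ : ρ.PosSemidef) (hA : A * Q = 0)
    (hA' : Q * A = 0) : bkmMetric (ρ + Q) A = bkmMetric ρ A := by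
  have hA'' : Aᴴ * Q = 0 := by
    have := congrArg Matrix.conjTranspose hA'
    rwa [Matrix.conjTranspose_mul, h.herm, Matrix.conjTranspose_zero] at this
  refine setIntegral_congr_fun measurableSet_Ioi fun s hs => ?_
  have e1 := mul_resolvent_add h hρ hA hs
  have e2 := mul_resolvent_add h hρ hA'' hs
  simp only [Matrix.mul_assoc, e1]
  simp only [← Matrix.mul_assoc, e2]

end KernelProjection

/-! ### Monotonicity of the metric for possibly singular states. -/

section Monotonicity

theorem re_trace_nonneg {A : Matrix n n ℂ} (h : A.PosSemidef) : 0 ≤ A.trace.re :=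
  (Complex.le_def.1 h.trace_nonneg).1

theorem IsKerProj.variational_add_le {ρ Q : Matrix n n ℂ} (h : IsKerProj ρ Q)
    (B : Matrix n n ℂ) {t : ℝ} (ht : 0 ≤ t) (Y : Matrix n n ℂ) :
    variational (ρ + Q) B t Y ≤ variational ρ B t Y := by
  have h1 := re_trace_nonneg (h.posSemidef.conjTranspose_mul_mul_same Y)
  have h2 := mul_nonneg ht (re_trace_nonneg (h.posSemidef.mul_mul_conjTranspose_same Y))
  simp only [variational, Matrix.mul_add, Matrix.add_mul, Matrix.trace_add, Complex.add_re]
  linarith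

theorem trace_compl_conj_le {M Q : Matrix n n ℂ} (hM : M.PosSemidef) (hQ : Qᴴ = Q)
    (hQ2 : Q * Q = Q) : ((1 - Q) * M * (1 - Q)).trace.re ≤ M.trace.re := by
  have h1 := re_trace_nonneg (hM.mul_mul_conjTranspose_same Q)
  rw [hQ, Matrix.mul_assoc, Matrix.trace_mul_comm, Matrix.mul_assoc, hQ2] at h1
  rw [Matrix.mul_assoc, Matrix.trace_mul_comm, Matrix.mul_assoc]
  have h2 : (1 - Q) * (1 - Q) = 1 - Q := by
    simp [Matrix.mul_sub, Matrix.sub_mul, hQ2]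
  rw [h2, Matrix.mul_sub, Matrix.mul_one, Matrix.trace_sub, Complex.sub_re]
  linarith

/-- Compressing X to the support leaves the linear term alone, since A lives there, hides Q from the
quadratic terms, and can only decrease those. -/
theorem IsKerProj.exists_variational_le {ρ Q : Matrix n n ℂ} (h : IsKerProj ρ Q)
    (hρ : ρ.PosSemidef) {A : Matrix n n ℂ} (hA : A * Q = 0) (hA' : Q * A = 0) {t : ℝ}
    (ht : 0 ≤ t) (X : Matrix n n ℂ) :
    variational ρ A t X ≤ variational (ρ + Q) A t ((1 - Q) * X * (1 - Q)) := by
  have hP : (1 - Q)ᴴ = 1 - Q := by rw [Matrix.conjTranspose_sub, Matrix.conjTranspose_one, h.herm]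
  have hX : ((1 - Q) * X * (1 - Q))ᴴ = (1 - Q) * Xᴴ * (1 - Q) := by
    rw [Matrix.conjTranspose_mul, Matrix.conjTranspose_mul, hP, Matrix.mul_assoc]
  have hPA : (1 - Q) * A * (1 - Q) = A := by
    simp [Matrix.mul_sub, Matrix.sub_mul, hA, hA']
  have e1 : ((1 - Q) * Xᴴ * (1 - Q) * A).trace = (Xᴴ * A).trace := by
    conv_rhs => rw [← hPA]
    rw [Matrix.mul_assoc, Matrix.mul_assoc, Matrix.trace_mul_comm]
    simp only [Matrix.mul_assoc]
  have e2 : ∀ Z W : Matrix n n ℂ, (1 - Q) * Z * (1 - Q) * (ρ + Q) * ((1 - Q) * W * (1 - Q)) =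
      (1 - Q) * (Z * ρ * W) * (1 - Q) := by
    intro Z W
    conv_rhs => rw [← h.compl_conj hρ]
    simp only [Matrix.mul_assoc]
  have i1 := trace_compl_conj_le (hρ.conjTranspose_mul_mul_same X) h.herm h.idem
  have i2 := mul_le_mul_of_nonneg_left
    (trace_compl_conj_le (hρ.mul_mul_conjTranspose_same X) h.herm h.idem) ht
  rw [variational, variational, hX, e1, e2, e2]
  linarith

/-- Comparing test matrices rather than states means that no relation between Φ(Q) and Q' is
required. -/
theorem Channel.bkmMetric_le (Φ : Channel n m) {ρ Q A : Matrix n n ℂ} {Q' : Matrix m m ℂ}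
    (hρ : ρ.PosSemidef) (hΦρ : (Φ ρ).PosSemidef) (hQ : IsKerProj ρ Q) (hQ' : IsKerProj (Φ ρ) Q')
    (hA : A * Q = 0) (hA' : Q * A = 0) :
    bkmMetric (Φ ρ + Q') (Φ A) ≤ bkmMetric (ρ + Q) A := by
  refine bkmMetric_le_of_variational (hQ.posDef_add hρ) (hQ'.posDef_add hΦρ) fun t ht Y => ?_
  obtain ⟨X, hX⟩ := Φ.exists_variational_le hρ A ht.le Y
  exact ⟨_, (hQ'.variational_add_le _ ht.le Y).trans
    (hX.trans (hQ.exists_variational_le hρ hA hA' ht.le X))⟩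

end Monotonicity

/-! ### Cauchy–Schwarz for the loss, and the bound by a domination constant. -/

section CauchySchwarz

variable {σ : Matrix n n ℂ}

theorem resolvent_isHermitian (hσ : σ.IsHermitian) (s : ℝ) :
    (σ + s • (1 : Matrix n n ℂ))⁻¹ᴴ = (σ + s • (1 : Matrix n n ℂ))⁻¹ := by
  rw [Matrix.conjTranspose_nonsing_inv, Matrix.conjTranspose_add, hσ.eq]
  simp

theorem bkmForm_comm (hσ : σ.IsHermitian) (A B : Matrix n n ℂ) :
    bkmForm σ A B = bkmForm σ B A := by
  unfold bkmForm
  congr 1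
  ext s
  have hR := resolvent_isHermitian hσ s
  set R := (σ + s • (1 : Matrix n n ℂ))⁻¹
  have : (Bᴴ * R * A * R).trace = star (Aᴴ * R * B * R).trace := by
    rw [← Matrix.trace_conjTranspose]
    simp only [Matrix.conjTranspose_mul, Matrix.conjTranspose_conjTranspose, hR]
    rw [Matrix.trace_mul_comm R]
    simp only [Matrix.mul_assoc]
  rw [this]
  simp

theorem integral_add_mul_add_mul_add_mul {μ : Measure ℝ} {f g h k : ℝ → ℝ} (hf : Integrable f μ)
    (hg : Integrable g μ) (hh : Integrable h μ) (hk : Integrable k μ) {x y z : ℝ} :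
    ∫ s, (f s + x * g s + y * h s + z * k s) ∂μ =
      ∫ s, f s ∂μ + x * ∫ s, g s ∂μ + y * ∫ s, h s ∂μ + z * ∫ s, k s ∂μ := by
  have hfg : Integrable (fun s => f s + x * g s) μ := hf.add (hg.const_mul x)
  have hfgh : Integrable (fun s => f s + x * g s + y * h s) μ := hfg.add (hh.const_mul y)
  rw [integral_add hfgh (hk.const_mul z), integral_add hfg (hh.const_mul y),
    integral_add hf (hg.const_mul x), integral_const_mul, integral_const_mul, integral_const_mul]

theorem bkmMetric_add_smul (hσ : σ.PosDef) (A B : Matrix n n ℂ) (x : ℝ) :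
    bkmMetric σ (A + x • B) =
      bkmMetric σ B * (x * x) + 2 * bkmForm σ A B * x + bkmMetric σ A := by
  have hAA := integrableOn_bkmForm hσ A A
  have hAB := integrableOn_bkmForm hσ A B
  have hBA := integrableOn_bkmForm hσ B A
  have hBB := integrableOn_bkmForm hσ B B
  have e : bkmMetric σ (A + x • B) =
      bkmForm σ A A + x * bkmForm σ A B + x * bkmForm σ B A + x * x * bkmForm σ B B := by
    unfold bkmForm bkmMetric
    rw [← integral_add_mul_add_mul_add_mul hAA hAB hBA hBB]
    congr 1
    ext s
    generalize (σ + s • (1 : Matrix n n ℂ))⁻¹ = R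
    simp only [Matrix.conjTranspose_add, Matrix.conjTranspose_smul, star_trivial, Matrix.add_mul,
      Matrix.mul_add, Matrix.smul_mul, Matrix.mul_smul, Matrix.trace_add, Matrix.trace_smul,
      Complex.add_re, Complex.real_smul, Complex.re_ofReal_mul]
    ring
  rw [e, bkmForm_comm hσ.1 B A, bkmMetric_eq_bkmForm, bkmMetric_eq_bkmForm]
  ring

theorem bkmForm_sub_le {τ : Matrix m m ℂ} (hσ : σ.PosDef) (hτ : τ.PosDef) {A B : Matrix n n ℂ}
    {A' B' : Matrix m m ℂ} (H : ∀ x : ℝ, bkmMetric τ (A' + x • B') ≤ bkmMetric σ (A + x • B)) :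
    bkmForm σ A B - bkmForm τ A' B' ≤
      √(bkmMetric σ A - bkmMetric τ A') * √(bkmMetric σ B - bkmMetric τ B') := by
  have hA : bkmMetric τ A' ≤ bkmMetric σ A := by simpa using H 0
  have h := discrim_le_zero (a := bkmMetric σ B - bkmMetric τ B')
    (b := 2 * (bkmForm σ A B - bkmForm τ A' B')) (c := bkmMetric σ A - bkmMetric τ A') fun x => by
      have := H x
      rw [bkmMetric_add_smul hσ, bkmMetric_add_smul hτ] at this
      linarith
  rw [discrim] at h
  rw [← Real.sqrt_mul (sub_nonneg.2 hA)]
  apply Real.le_sqrt_of_sq_le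
  linarith

/-- With A = S*S and resolvent R, tr(A R (Cσ − A) R) = tr(SR (Cσ − A)(SR)*) ≥ 0 in real part for
every s; the σ term integrates to C Re tr A. -/
theorem bkmMetric_le_of_le_smul (hσ : σ.PosDef) {A : Matrix n n ℂ} (hA : A.PosSemidef) {C : ℝ}
    (h : A ≤ C • σ) : bkmMetric σ A ≤ C * A.trace.re := by
  rw [← bkmForm_self_right hσ, bkmForm, ← integral_const_mul]
  refine setIntegral_mono_on (integrableOn_bkmForm hσ A A)
    ((integrableOn_bkmForm hσ A σ).const_mul C) measurableSet_Ioi fun s _ => ?_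
  have hR := resolvent_isHermitian hσ.1 s
  set R := (σ + s • (1 : Matrix n n ℂ))⁻¹
  obtain ⟨S, hS⟩ := exists_eq_star_mul_self hA.nonneg
  rw [Matrix.star_eq_conjTranspose] at hS
  have h1 := re_trace_nonneg ((Matrix.le_iff.1 h).mul_mul_conjTranspose_same (S * R))
  have h2 : (S * R * (C • σ - A) * (S * R)ᴴ).trace = (Aᴴ * R * (C • σ - A) * R).trace := by
    rw [hA.1.eq, Matrix.conjTranspose_mul, hR, ← Matrix.mul_assoc, Matrix.trace_mul_comm]
    congr 1
    generalize C • σ - A = M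
    rw [hS]
    simp only [Matrix.mul_assoc]
  rw [h2, Matrix.mul_sub, Matrix.sub_mul, Matrix.mul_smul, Matrix.smul_mul, Matrix.trace_sub,
    Matrix.trace_smul, Complex.sub_re, Complex.real_smul, Complex.re_ofReal_mul] at h1
  linarith

end CauchySchwarz

/-! ### The optimal domination constant. -/

section MaxRatio

/-- The exponential of the max-relative entropy. -/
def maxRatio (ρ σ : Matrix n n ℂ) : ℝ := sInf {C : ℝ | 0 < C ∧ ρ ≤ C • σ}

variable {ρ σ : Matrix n n ℂ}

theorem maxRatio_le {C : ℝ} (hC : 0 < C) (h : ρ ≤ C • σ) : maxRatio ρ σ ≤ C :=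
  csInf_le ⟨0, fun _ hx => hx.1.le⟩ ⟨hC, h⟩

theorem le_maxRatio_smul (h : ∃ C : ℝ, 0 < C ∧ ρ ≤ C • σ) : ρ ≤ maxRatio ρ σ • σ := by
  have hcl : IsClosed {C : ℝ | ρ ≤ C • σ} := isClosed_le continuous_const (by fun_prop)
  have := csInf_mem_closure (s := {C : ℝ | 0 < C ∧ ρ ≤ C • σ}) h ⟨0, fun _ hx => hx.1.le⟩
  exact (hcl.closure_subset_iff.2 fun C hC => hC.2) this

theorem one_le_of_le_smul (hρ : IsDensity ρ) (hσ : IsDensity σ) {C : ℝ} (h : ρ ≤ C • σ) :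
    1 ≤ C := by
  have := re_trace_nonneg (Matrix.le_iff.1 h)
  rw [Matrix.trace_sub, Matrix.trace_smul, hρ.2, hσ.2] at this
  simpa using this

theorem one_le_maxRatio (hρ : IsDensity ρ) (hσ : IsDensity σ)
    (h : ∃ C : ℝ, 0 < C ∧ ρ ≤ C • σ) : 1 ≤ maxRatio ρ σ :=
  one_le_of_le_smul hρ hσ (le_maxRatio_smul h)

/-- Turns sublevel sets into Loewner inequalities, which are closed conditions on σ. Equal traces
force C ≥ 1, so positivity of C need not be assumed. -/
theorem maxRatio_le_iff (hρ : IsDensity ρ) (hσ : IsDensity σ)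
    (h : ∃ C : ℝ, 0 < C ∧ ρ ≤ C • σ) {C : ℝ} : maxRatio ρ σ ≤ C ↔ ρ ≤ C • σ := by
  refine ⟨fun hC => (le_maxRatio_smul h).trans ?_, fun hC =>
    maxRatio_le (one_pos.trans_le (one_le_of_le_smul hρ hσ hC)) hC⟩
  exact smul_le_smul_of_nonneg_right hC hσ.1.nonneg

theorem exp_half_dMax (hρ : IsDensity ρ) (hσ : IsDensity σ)
    (h : ∃ C : ℝ, 0 < C ∧ ρ ≤ C • σ) :
    Real.exp ((dMax ρ σ).toReal / 2) = √(maxRatio ρ σ) := by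
  have h1 := one_le_maxRatio hρ hσ h
  rw [dMax, if_pos h, EReal.toReal_coe, Real.exp_half, ← maxRatio, Real.exp_log (one_pos.trans_le h1)]

theorem IsDensity.le_one (hρ : IsDensity ρ) : ρ ≤ 1 := by
  obtain ⟨U, d, h, -, -⟩ := exists_isDiag hρ.1.1
  have h1 : Uᴴ * ρ * U = Matrix.diagonal (fun i => (d i : ℂ)) := by
    have : Uᴴ * (U * Matrix.diagonal (fun i => (d i : ℂ)) * Uᴴ) * U =
        (Uᴴ * U) * Matrix.diagonal (fun i => (d i : ℂ)) * (Uᴴ * U) := by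
      simp only [Matrix.mul_assoc]
    rw [h.eq, this, h.left, Matrix.one_mul, Matrix.mul_one]
  have hd : ∀ i, 0 ≤ d i := by
    have := hρ.1.conjTranspose_mul_mul_same U
    rw [h1, Matrix.posSemidef_diagonal_iff] at this
    exact fun i => by simpa using this i
  have htr : ∑ i, d i = 1 := by
    have h2 : (Uᴴ * ρ * U).trace = 1 := by
      rw [Matrix.trace_mul_comm, ← Matrix.mul_assoc, h.right, Matrix.one_mul, hρ.2]
    rw [h1, Matrix.trace_diagonal] at h2
    exact_mod_cast h2
  have hd1 : ∀ i, d i ≤ 1 := fun i => htr ▸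
    Finset.single_le_sum (fun j _ => hd j) (Finset.mem_univ i)
  rw [Matrix.le_iff]
  have h3 : (1 : Matrix n n ℂ) - ρ = U * Matrix.diagonal (fun i => ((1 - d i : ℝ) : ℂ)) * Uᴴ := by
    have : Matrix.diagonal (fun i => ((1 - d i : ℝ) : ℂ)) =
        1 - Matrix.diagonal (fun i => (d i : ℂ)) := by
      rw [← Matrix.diagonal_one, Matrix.diagonal_sub]; simp
    rw [this, Matrix.mul_sub, Matrix.sub_mul, Matrix.mul_one, h.right, ← h.eq]
  rw [h3]
  refine Matrix.PosSemidef.mul_mul_conjTranspose_same (Matrix.posSemidef_diagonal_iff.2 fun i => ?_)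
    U
  have := hd1 i
  exact_mod_cast sub_nonneg.2 this

theorem aemeasurable_maxRatio {T : Set ℝ} (hT : MeasurableSet T) {σ : ℝ → Matrix n n ℂ}
    (hσ : ContinuousOn σ T) (hρ : IsDensity ρ) (hd : ∀ θ ∈ T, IsDensity (σ θ))
    (h : ∀ θ ∈ T, ∃ C : ℝ, 0 < C ∧ ρ ≤ C • σ θ) :
    AEMeasurable (fun θ => maxRatio ρ (σ θ)) (volume.restrict T) := by
  refine aemeasurable_restrict_of_measurable_subtype hT (measurable_of_Iic fun c => ?_)
  have : (fun θ : T => maxRatio ρ (σ θ)) ⁻¹' Iic c = {θ : T | ρ ≤ c • σ θ} := by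
    ext θ
    exact maxRatio_le_iff hρ (hd θ θ.2) (h θ θ.2)
  rw [this]
  exact (isClosed_le continuous_const
    ((continuousOn_iff_continuous_domRestrict.1 hσ).const_smul c)).measurableSet

end MaxRatio

/-! ### Channels acting on states and supports. -/

section Channel

theorem Channel.posSemidef (Φ : Channel n m) {ρ : Matrix n n ℂ} (hρ : ρ.PosSemidef) :
    (Φ ρ).PosSemidef := by
  obtain ⟨S, rfl⟩ := exists_eq_star_mul_self hρ.nonneg
  obtain ⟨K, hK⟩ := Φ.two_positive ![S, S]
  have := hK 0 0
  simp only [Matrix.cons_val_zero] at this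
  rw [Matrix.star_eq_conjTranspose, this]
  exact Matrix.posSemidef_sum _ fun k _ => Matrix.posSemidef_conjTranspose_mul_self _

/-- A channel as a real continuous linear map. -/
def Channel.toCLM (Φ : Channel n m) : Matrix n n ℂ →L[ℝ] Matrix m m ℂ :=
  LinearMap.toContinuousLinearMap (Φ.toCP.toLinearMap.restrictScalars ℝ)

theorem Channel.toCLM_apply (Φ : Channel n m) (A : Matrix n n ℂ) : Φ.toCLM A = Φ A := rfl

/-- Support inclusion amounts to domination by a multiple, which a positive linear map preserves. -/
theorem Channel.suppLE (Φ : Channel n m) {ρ σ : Matrix n n ℂ} (hρ : ρ.PosSemidef)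
    (hσ : σ.PosSemidef) (h : SuppLE ρ σ) : SuppLE (Φ ρ) (Φ σ) := by
  obtain ⟨C, -, hC⟩ := exists_le_smul hρ hσ h
  refine suppLE_of_le_smul (C := C) (Φ.posSemidef hρ) ?_
  have := Φ.posSemidef (Matrix.le_iff.1 hC)
  rw [← Φ.toCLM_apply, map_sub, map_smul] at this
  exact this

theorem Channel.isDensity (Φ : Channel n m) {ρ : Matrix n n ℂ} (hρ : IsDensity ρ) :
    IsDensity (Φ ρ) :=
  ⟨Φ.posSemidef hρ.1, (Φ.trace_map ρ).trans hρ.2⟩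

end Channel

theorem bkmMetric_nonneg {σ : Matrix n n ℂ} (hσ : σ.PosDef) (A : Matrix n n ℂ) :
    0 ≤ bkmMetric σ A := by
  obtain ⟨U, d, h, -, hd⟩ := exists_isDiag hσ.1
  replace hd := hd hσ
  rw [(bkmMetric_eq_integral h hd A).2]
  refine setIntegral_nonneg measurableSet_Ioi fun t ht => ?_
  have ht' : (0 : ℝ) < t := ht
  refine mul_nonneg (by positivity) (Finset.sum_nonneg fun i _ => Finset.sum_nonneg fun j _ => ?_)
  have := hd i
  have := hd j
  exact mul_nonneg (Complex.normSq_nonneg _) (by positivity)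

/-! ### Families with a common kernel. -/

section Family

/-- A `C¹` family of states on `[0,1]` whose kernel projection is constantly `Q`. -/
structure IsStateFamily (ρ ρ' : ℝ → Matrix n n ℂ) (Q : Matrix n n ℂ) : Prop where
  density : ∀ θ ∈ Icc (0 : ℝ) 1, IsDensity (ρ θ)
  kerProj : ∀ θ ∈ Icc (0 : ℝ) 1, IsKerProj (ρ θ) Q
  hasDeriv : ∀ θ ∈ Icc (0 : ℝ) 1, HasDerivWithinAt ρ (ρ' θ) (Icc 0 1) θ
  continuousOn_deriv : ContinuousOn ρ' (Icc 0 1)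

variable {ρ ρ' : ℝ → Matrix n n ℂ} {Q : Matrix n n ℂ}

namespace IsStateFamily

theorem continuousOn (h : IsStateFamily ρ ρ' Q) : ContinuousOn ρ (Icc 0 1) :=
  fun θ hθ => (h.hasDeriv θ hθ).continuousWithinAt

theorem derivWithin_eq (h : IsStateFamily ρ ρ' Q) {θ : ℝ} (hθ : θ ∈ Icc (0 : ℝ) 1) :
    derivWithin ρ (Icc 0 1) θ = ρ' θ :=
  (h.hasDeriv θ hθ).derivWithin (uniqueDiffOn_Icc zero_lt_one θ hθ)

/-- Differentiate the identity ρ_t Q = 0, whose Q is independent of t; uniqueness of derivatives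
within [0,1] covers the endpoints. -/
theorem deriv_mul (h : IsStateFamily ρ ρ' Q) {θ : ℝ} (hθ : θ ∈ Icc (0 : ℝ) 1) : ρ' θ * Q = 0 := by
  have h1 := (h.hasDeriv θ hθ).mul_const Q
  have h2 : HasDerivWithinAt (fun t => ρ t * Q) 0 (Icc 0 1) θ :=
    (hasDerivWithinAt_const θ (Icc (0 : ℝ) 1) (0 : Matrix n n ℂ)).congr
      (fun t ht => (h.kerProj t ht).mul_eq_zero) (h.kerProj θ hθ).mul_eq_zero
  exact (uniqueDiffOn_Icc zero_lt_one θ hθ).eq_deriv _ h1 h2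

theorem mul_deriv (h : IsStateFamily ρ ρ' Q) {θ : ℝ} (hθ : θ ∈ Icc (0 : ℝ) 1) : Q * ρ' θ = 0 := by
  have h1 := (h.hasDeriv θ hθ).const_mul Q
  have h2 : HasDerivWithinAt (fun t => Q * ρ t) 0 (Icc 0 1) θ :=
    (hasDerivWithinAt_const θ (Icc (0 : ℝ) 1) (0 : Matrix n n ℂ)).congr
      (fun t ht => (h.kerProj t ht).mul_eq_zero' (h.density t ht).1)
      ((h.kerProj θ hθ).mul_eq_zero' (h.density θ hθ).1)
  exact (uniqueDiffOn_Icc zero_lt_one θ hθ).eq_deriv _ h1 h2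

theorem posDef (h : IsStateFamily ρ ρ' Q) {θ : ℝ} (hθ : θ ∈ Icc (0 : ℝ) 1) : (ρ θ + Q).PosDef :=
  (h.kerProj θ hθ).posDef_add (h.density θ hθ).1

theorem continuousOn_add (h : IsStateFamily ρ ρ' Q) :
    ContinuousOn (fun θ => ρ θ + Q) (Icc 0 1) :=
  h.continuousOn.add continuousOn_const

theorem bkmFisher_eq (h : IsStateFamily ρ ρ' Q) {θ : ℝ} (hθ : θ ∈ Icc (0 : ℝ) 1) :
    bkmFisher ρ θ = bkmMetric (ρ θ + Q) (ρ' θ) := by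
  rw [bkmFisher, h.derivWithin_eq hθ, bkmMetric_add_kerProj (h.kerProj θ hθ) (h.density θ hθ).1
    (h.deriv_mul hθ) (h.mul_deriv hθ)]

theorem continuousOn_bkmFisher (h : IsStateFamily ρ ρ' Q) :
    ContinuousOn (bkmFisher ρ) (Icc 0 1) :=
  (continuousOn_bkmForm isCompact_Icc h.continuousOn_add (fun _ hθ => h.posDef hθ)
    h.continuousOn_deriv h.continuousOn_deriv).congr fun _ hθ => h.bkmFisher_eq hθ

theorem suppLE (h : IsStateFamily ρ ρ' Q) {a b : ℝ} (ha : a ∈ Icc (0 : ℝ) 1)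
    (hb : b ∈ Icc (0 : ℝ) 1) : SuppLE (ρ a) (ρ b) := by
  intro v hv
  have := (h.kerProj b hb).mulVec_eq v hv
  rw [← this, Matrix.mulVec_mulVec, (h.kerProj a ha).mul_eq_zero, Matrix.zero_mulVec]

theorem map (h : IsStateFamily ρ ρ' Q) (Φ : Channel n m) {Q' : Matrix m m ℂ}
    (hQ' : IsKerProj (Φ (ρ 0)) Q') :
    IsStateFamily (fun θ => Φ (ρ θ)) (fun θ => Φ (ρ' θ)) Q' where
  density θ hθ := Φ.isDensity (h.density θ hθ)
  kerProj θ hθ := by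
    have h0 : (0 : ℝ) ∈ Icc (0 : ℝ) 1 := by simp
    exact hQ'.of_suppLE (Φ.suppLE (h.density θ hθ).1 (h.density 0 h0).1 (h.suppLE hθ h0))
      (Φ.suppLE (h.density 0 h0).1 (h.density θ hθ).1 (h.suppLE h0 hθ))
  hasDeriv θ hθ := Φ.toCLM.hasFDerivAt.comp_hasDerivWithinAt θ (h.hasDeriv θ hθ)
  continuousOn_deriv := Φ.toCLM.continuous.comp_continuousOn h.continuousOn_deriv

theorem relEntropy_eq (h : IsStateFamily ρ ρ' Q) : relEntropy (ρ 1) (ρ 0) =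
    ((∫ θ in (0 : ℝ)..1, bkmForm (ρ θ + Q) (ρ 1) (ρ' θ) : ℝ) : EReal) := by
  have h0 : (0 : ℝ) ∈ Icc (0 : ℝ) 1 := by simp
  have h1 : (1 : ℝ) ∈ Icc (0 : ℝ) 1 := by simp
  have key := trace_mul_log_sub (σ := fun θ => ρ θ + Q) ρ' (ρ 1) h.continuousOn_add
    (fun _ hθ => h.posDef hθ) h.continuousOn_deriv fun θ hθ =>
      ((h.hasDeriv θ (Ioo_subset_Icc_self hθ)).hasDerivAt (Icc_mem_nhds hθ.1 hθ.2)).add_const Q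
  simp only [(h.kerProj 0 h0).log_add (h.density 0 h0).1,
    (h.kerProj 1 h1).log_add (h.density 1 h1).1, (h.density 1 h1).1.1.eq] at key
  rw [relEntropy, if_pos (h.suppLE h1 h0), Matrix.trace_sub, Complex.sub_re, key]

theorem intervalIntegrable_bkmForm (h : IsStateFamily ρ ρ' Q) (A : Matrix n n ℂ) :
    IntervalIntegrable (fun θ => bkmForm (ρ θ + Q) A (ρ' θ)) volume 0 1 :=
  (continuousOn_bkmForm isCompact_Icc h.continuousOn_add (fun _ hθ => h.posDef hθ)
    continuousOn_const h.continuousOn_deriv).intervalIntegrable_of_Icc zero_le_one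

theorem exists_forall_maxRatio_le (h : IsStateFamily ρ ρ' Q) :
    ∃ K : ℝ, ∀ θ ∈ Icc (0 : ℝ) 1, maxRatio (ρ 1) (ρ θ) ≤ K := by
  have h1 : (1 : ℝ) ∈ Icc (0 : ℝ) 1 := by simp
  obtain ⟨c, hc, hcT⟩ := exists_uniform_lower_bound isCompact_Icc h.continuousOn_add
    (fun _ hθ => h.posDef hθ)
  refine ⟨1 * c⁻¹, fun θ hθ => maxRatio_le (by positivity) ?_⟩
  exact (h.kerProj θ hθ).le_smul (h.density 1 h1).1 (h.density θ hθ).1 (h.suppLE h1 hθ) hc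
    (hcT θ hθ) zero_le_one (by simpa using (h.density 1 h1).le_one)

theorem exists_le_smul (h : IsStateFamily ρ ρ' Q) {θ : ℝ} (hθ : θ ∈ Icc (0 : ℝ) 1) :
    ∃ C : ℝ, 0 < C ∧ ρ 1 ≤ C • ρ θ :=
  BKM.exists_le_smul (h.density 1 (by simp)).1 (h.density θ hθ).1 (h.suppLE (by simp) hθ)

/-- Boundedness and measurability of the ratio suffice; its continuity in θ is not needed. -/
theorem intervalIntegrable_sqrt_maxRatio_mul (h : IsStateFamily ρ ρ' Q) {f : ℝ → ℝ}
    (hf : ContinuousOn f (Icc 0 1)) :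
    IntervalIntegrable (fun θ => √(maxRatio (ρ 1) (ρ θ)) * f θ) volume 0 1 := by
  obtain ⟨K, hK⟩ := h.exists_forall_maxRatio_le
  have hm := aemeasurable_maxRatio measurableSet_Icc h.continuousOn (h.density 1 (by simp))
    h.density fun θ hθ => h.exists_le_smul hθ
  rw [intervalIntegrable_iff_integrableOn_Icc_of_le zero_le_one]
  refine (hf.integrableOn_compact isCompact_Icc).bdd_mul (c := √K) hm.sqrt.aestronglyMeasurable
    ((ae_restrict_iff' measurableSet_Icc).2 (.of_forall fun θ hθ => ?_))
  rw [Real.norm_of_nonneg (Real.sqrt_nonneg _)]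
  exact Real.sqrt_le_sqrt (hK θ hθ)

variable {Q' : Matrix m m ℂ} {Φ : Channel n m}

theorem bkmLoss_eq (h : IsStateFamily ρ ρ' Q)
    (h' : IsStateFamily (fun θ => Φ (ρ θ)) (fun θ => Φ (ρ' θ)) Q') {θ : ℝ}
    (hθ : θ ∈ Icc (0 : ℝ) 1) :
    bkmLoss Φ ρ θ = bkmMetric (ρ θ + Q) (ρ' θ) - bkmMetric (Φ (ρ θ) + Q') (Φ (ρ' θ)) := by
  rw [bkmLoss, h.bkmFisher_eq hθ, h'.bkmFisher_eq hθ]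

theorem bkmLoss_nonneg (h : IsStateFamily ρ ρ' Q)
    (h' : IsStateFamily (fun θ => Φ (ρ θ)) (fun θ => Φ (ρ' θ)) Q') {θ : ℝ}
    (hθ : θ ∈ Icc (0 : ℝ) 1) : 0 ≤ bkmLoss Φ ρ θ := by
  rw [h.bkmLoss_eq h' hθ, sub_nonneg]
  exact Φ.bkmMetric_le (h.density θ hθ).1 (h'.density θ hθ).1 (h.kerProj θ hθ) (h'.kerProj θ hθ)
    (h.deriv_mul hθ) (h.mul_deriv hθ)

theorem continuousOn_sqrt_bkmLoss (h : IsStateFamily ρ ρ' Q)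
    (h' : IsStateFamily (fun θ => Φ (ρ θ)) (fun θ => Φ (ρ' θ)) Q') :
    ContinuousOn (fun θ => √(bkmLoss Φ ρ θ)) (Icc 0 1) :=
  (h.continuousOn_bkmFisher.sub h'.continuousOn_bkmFisher).sqrt

theorem bkmForm_sub_le (h : IsStateFamily ρ ρ' Q)
    (h' : IsStateFamily (fun θ => Φ (ρ θ)) (fun θ => Φ (ρ' θ)) Q') {θ : ℝ}
    (hθ : θ ∈ Icc (0 : ℝ) 1) :
    bkmForm (ρ θ + Q) (ρ 1) (ρ' θ) - bkmForm (Φ (ρ θ) + Q') (Φ (ρ 1)) (Φ (ρ' θ)) ≤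
      √(maxRatio (ρ 1) (ρ θ)) * √(bkmLoss Φ ρ θ) := by
  have h1 : (1 : ℝ) ∈ Icc (0 : ℝ) 1 := by simp
  have hρ1 := h.density 1 h1
  refine (BKM.bkmForm_sub_le (h.posDef hθ) (h'.posDef hθ) fun x => ?_).trans ?_
  · have e : Φ (ρ 1) + x • Φ (ρ' θ) = Φ (ρ 1 + x • ρ' θ) := by
      simp only [← Φ.toCLM_apply, map_add, map_smul]
    rw [e]
    refine Φ.bkmMetric_le (h.density θ hθ).1 (h'.density θ hθ).1 (h.kerProj θ hθ)
      (h'.kerProj θ hθ) ?_ ?_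
    · rw [Matrix.add_mul, Matrix.smul_mul, h.deriv_mul hθ, (h.kerProj 1 h1).mul_eq_zero]
      simp
    · rw [Matrix.mul_add, Matrix.mul_smul, h.mul_deriv hθ, (h.kerProj 1 h1).mul_eq_zero' hρ1.1]
      simp
  · rw [h.bkmLoss_eq h' hθ]
    gcongr
    have hC := h.exists_le_smul hθ
    have hle : ρ 1 ≤ maxRatio (ρ 1) (ρ θ) • (ρ θ + Q) := by
      rw [smul_add]
      refine (le_maxRatio_smul hC).trans (le_add_of_nonneg_right ?_)
      exact smul_nonneg (zero_le_one.trans (one_le_maxRatio hρ1 (h.density θ hθ) hC))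
        (h.kerProj θ hθ).posSemidef.nonneg
    have h2 := bkmMetric_le_of_le_smul (h.posDef hθ) hρ1.1 hle
    rw [hρ1.2, Complex.one_re, mul_one] at h2
    -- In the loss at ρ₁ the output metric is simply discarded.
    have h3 := bkmMetric_nonneg (h'.posDef hθ) (Φ (ρ 1))
    linarith

theorem relEntropy_sub_le (h : IsStateFamily ρ ρ' Q)
    (h' : IsStateFamily (fun θ => Φ (ρ θ)) (fun θ => Φ (ρ' θ)) Q') :
    relEntropy (ρ 1) (ρ 0) - relEntropy (Φ (ρ 1)) (Φ (ρ 0)) ≤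
      ((∫ θ in (0 : ℝ)..1, √(maxRatio (ρ 1) (ρ θ)) * √(bkmLoss Φ ρ θ) : ℝ) : EReal) := by
  rw [h.relEntropy_eq, h'.relEntropy_eq, ← EReal.coe_sub, EReal.coe_le_coe_iff,
    ← intervalIntegral.integral_sub (h.intervalIntegrable_bkmForm _)
      (h'.intervalIntegrable_bkmForm _)]
  exact intervalIntegral.integral_mono_on zero_le_one
    ((h.intervalIntegrable_bkmForm _).sub (h'.intervalIntegrable_bkmForm _))
    (h.intervalIntegrable_sqrt_maxRatio_mul (h.continuousOn_sqrt_bkmLoss h'))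
    fun θ hθ => h.bkmForm_sub_le h' hθ

end IsStateFamily

theorem exists_isStateFamily {ρ : ℝ → Matrix n n ℂ} (hsmooth : ContDiffOn ℝ ∞ ρ (Icc 0 1))
    (hρ : ∀ θ ∈ Icc (0 : ℝ) 1, IsDensity (ρ θ))
    (hsupp : ∀ θ ∈ Icc (0 : ℝ) 1, SuppLE (ρ θ) (ρ 0) ∧ SuppLE (ρ 0) (ρ θ)) (Φ : Channel n m) :
    ∃ ρ' Q Q', IsStateFamily ρ ρ' Q ∧ IsStateFamily (fun θ => Φ (ρ θ)) (fun θ => Φ (ρ' θ)) Q' := by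
  have h0 : (0 : ℝ) ∈ Icc (0 : ℝ) 1 := by simp
  obtain ⟨Q, hQ, -⟩ := exists_isKerProj (hρ 0 h0).1
  obtain ⟨Q', hQ', -⟩ := exists_isKerProj (Φ.posSemidef (hρ 0 h0).1)
  have h : IsStateFamily ρ (derivWithin ρ (Icc 0 1)) Q :=
    ⟨hρ, fun θ hθ => hQ.of_suppLE (hsupp θ hθ).1 (hsupp θ hθ).2,
      fun θ hθ => (hsmooth.differentiableOn (by simp) θ hθ).hasDerivWithinAt,
      hsmooth.continuousOn_derivWithin (uniqueDiffOn_Icc zero_lt_one) (by simp)⟩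
  exact ⟨_, Q, Q', h, h.map Φ hQ'⟩

end Family

end BKM

end

/-! ### The two bounds. -/

theorem theorem5p3 {n m : Type*} [Fintype n] [DecidableEq n] [Fintype m] [DecidableEq m]
    (Φ : BKM.Channel n m) (ρ : ℝ → Matrix n n ℂ)
    (hsmooth : ContDiffOn ℝ ∞ ρ (Icc 0 1))
    (hρ : ∀ θ ∈ Icc (0 : ℝ) 1, BKM.IsDensity (ρ θ)) :
    -- families of states with a common support
    ((∀ θ ∈ Icc (0 : ℝ) 1, BKM.SuppLE (ρ θ) (ρ 0) ∧ BKM.SuppLE (ρ 0) (ρ θ)) →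
      BKM.relEntropy (ρ 1) (ρ 0) ≠ ⊤ ∧
      BKM.relEntropy (Φ (ρ 1)) (Φ (ρ 0)) ≠ ⊤ ∧
      (∀ θ ∈ Icc (0 : ℝ) 1, BKM.dMax (ρ 1) (ρ θ) ≠ ⊤) ∧
      (∀ θ ∈ Icc (0 : ℝ) 1, 0 ≤ BKM.bkmLoss Φ ρ θ) ∧
      IntervalIntegrable (fun θ => Real.exp ((BKM.dMax (ρ 1) (ρ θ)).toReal / 2) *
        √(BKM.bkmLoss Φ ρ θ)) MeasureTheory.volume 0 1 ∧
      BKM.relEntropy (ρ 1) (ρ 0) - BKM.relEntropy (Φ (ρ 1)) (Φ (ρ 0)) ≤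
        ((∫ θ in (0 : ℝ)..1, Real.exp ((BKM.dMax (ρ 1) (ρ θ)).toReal / 2) *
          √(BKM.bkmLoss Φ ρ θ) : ℝ) : EReal)) ∧
    -- families of states bounded below by a positive multiple of the identity
    (∀ lam : ℝ, 0 < lam → (∀ θ ∈ Icc (0 : ℝ) 1, lam • (1 : Matrix n n ℂ) ≤ ρ θ) →
      BKM.relEntropy (ρ 1) (ρ 0) ≠ ⊤ ∧
      BKM.relEntropy (Φ (ρ 1)) (Φ (ρ 0)) ≠ ⊤ ∧
      IntervalIntegrable (fun θ => √(BKM.bkmLoss Φ ρ θ)) MeasureTheory.volume 0 1 ∧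
      BKM.relEntropy (ρ 1) (ρ 0) - BKM.relEntropy (Φ (ρ 1)) (Φ (ρ 0)) ≤
        ((lam ^ (-(1 / 2) : ℝ) * ∫ θ in (0 : ℝ)..1, √(BKM.bkmLoss Φ ρ θ) : ℝ) : EReal)) := by
  have h0 : (0 : ℝ) ∈ Icc (0 : ℝ) 1 := by simp
  have h1 : (1 : ℝ) ∈ Icc (0 : ℝ) 1 := by simp
  refine ⟨fun hsupp => ?_, fun lam hlam hbound => ?_⟩
  · obtain ⟨ρ', Q, Q', h, h'⟩ := BKM.exists_isStateFamily hsmooth hρ hsupp Φ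
    have hexp : ∀ θ ∈ Icc (0 : ℝ) 1, √(BKM.maxRatio (ρ 1) (ρ θ)) * √(BKM.bkmLoss Φ ρ θ) =
        Real.exp ((BKM.dMax (ρ 1) (ρ θ)).toReal / 2) * √(BKM.bkmLoss Φ ρ θ) := fun θ hθ => by
      rw [BKM.exp_half_dMax (hρ 1 h1) (hρ θ hθ) (h.exists_le_smul hθ)]
    refine ⟨?_, ?_, fun θ hθ => ?_, fun θ hθ => h.bkmLoss_nonneg h' hθ, ?_, ?_⟩
    · rw [h.relEntropy_eq]; exact EReal.coe_ne_top _
    · rw [h'.relEntropy_eq]; exact EReal.coe_ne_top _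
    · rw [BKM.dMax, if_pos (h.exists_le_smul hθ)]; exact EReal.coe_ne_top _
    · refine (h.intervalIntegrable_sqrt_maxRatio_mul (h.continuousOn_sqrt_bkmLoss h')).congr ?_
      intro θ hθ
      rw [uIoc_of_le zero_le_one] at hθ
      exact hexp θ (Ioc_subset_Icc_self hθ)
    · refine (h.relEntropy_sub_le h').trans (le_of_eq ?_)
      congr 1
      refine intervalIntegral.integral_congr fun θ hθ => ?_
      rw [uIcc_of_le zero_le_one] at hθ
      exact hexp θ hθ
  · have hpos : ∀ θ ∈ Icc (0 : ℝ) 1, (ρ θ).PosDef := fun θ hθ =>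
      BKM.posDef_of_smul_one_le hlam (hbound θ hθ)
    have hker : ∀ a ∈ Icc (0 : ℝ) 1, ∀ b, BKM.SuppLE (ρ b) (ρ a) := fun a ha b v hv => by
      have hv0 : v = 0 := Matrix.mulVec_injective_of_isUnit (hpos a ha).isUnit (by simpa using hv)
      rw [hv0, Matrix.mulVec_zero]
    obtain ⟨ρ', Q, Q', h, h'⟩ := BKM.exists_isStateFamily hsmooth hρ
      (fun θ hθ => ⟨hker 0 h0 θ, hker θ hθ 0⟩) Φ
    have hint := (h.continuousOn_sqrt_bkmLoss h').intervalIntegrable_of_Icc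
      (μ := MeasureTheory.volume) zero_le_one
    refine ⟨?_, ?_, hint, ?_⟩
    · rw [h.relEntropy_eq]; exact EReal.coe_ne_top _
    · rw [h'.relEntropy_eq]; exact EReal.coe_ne_top _
    · refine (h.relEntropy_sub_le h').trans ?_
      rw [EReal.coe_le_coe_iff, ← intervalIntegral.integral_const_mul]
      refine intervalIntegral.integral_mono_on zero_le_one
        (h.intervalIntegrable_sqrt_maxRatio_mul (h.continuousOn_sqrt_bkmLoss h'))
        (hint.const_mul _) fun θ hθ => ?_
      -- A state is at most 1, so ρ₁ ≤ 1 ≤ λ⁻¹ρ_θ.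
      have hle : BKM.maxRatio (ρ 1) (ρ θ) ≤ lam⁻¹ := by
        refine BKM.maxRatio_le (inv_pos.2 hlam) ((hρ 1 h1).le_one.trans ?_)
        have := smul_le_smul_of_nonneg_left (hbound θ hθ) (inv_pos.2 hlam).le
        rwa [smul_smul, inv_mul_cancel₀ hlam.ne', one_smul] at this
      have hpow : lam ^ (-(1 / 2) : ℝ) = √(lam⁻¹) := by
        rw [Real.rpow_neg hlam.le, Real.sqrt_inv, Real.sqrt_eq_rpow]
      rw [hpow]
      gcongr
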